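/- **Setting.** Let $\mathcal X,\mathcal Y,\mathcal Z_A,\mathcal Z_B$ be finite sets, $f_A:\mathcal X\times\mathcal Y\to\mathcal Z_A$, $f_B:\mathcal X\times\mathcal Y\to\mathcal Z_B$, and let $X,Y$ be random variables with values in $\mathcal X,\mathcal Y$. Let $U^1,\dots,U^t$ be binary random variables, jointly distributed with $(X,Y)$, such that for $i=1,\dots,t$ $$U^i\to(X,U^{1:i-1})\to Y\ \ (i\text{ odd}),\qquad U^i\to(Y,U^{1:i-1})\to X\ \ (i\text{ even})$$ are Markov chains, and $H(f_A(X,Y)\mid X,U^{1:t})=0$, $H(f_B(X,Y)\mid Y,U^{1:t})=0$. Let $N=2^n$. Let $P$ be the joint law of $N$ independent copies of $(X,Y,U^1,\dots,U^t)$; a bar denotes an $N$-vector, $v(j)$ is the $j$-th entry of $\bar v$ and $v(1{:}j-1)$ the vector of the preceding ones. Let $\bar V^i=\bar U^iG_N$ over $\mathbb F_2$, where $G_N=B_NF^{\otimes n}$, $F=\begin{pmatrix}1&0\\1&1\end{pmatrix}$, and $B_N$ is the bit-reversal permutation matrix. For a binary $T$ put $Z(T\mid W)=2\sum_wP_W(w)\sqrt{P_{T|W}(0|w)P_{T|W}(1|w)}$.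 Let $0<\beta<1/2$, $\delta_N=2^{-N^\beta}$, and for side information $\bar W$ (possibly absent) let $$\mathcal H_{U^i|W}=\{j: Z(V^i(j)\mid V^i(1{:}j-1),\bar W)\ge1-\delta_N\},\qquad \mathcal L_{U^i|W}=\{j: Z(V^i(j)\mid V^i(1{:}j-1),\bar W)\le\delta_N\}.$$ **Protocol.** Terminal A observes $\bar X$ and Terminal B observes $\bar Y$. In round $i$ the transmitter is A if $i$ is odd and B if $i$ is even; let $S$ be $(X,U^{1:i-1})$ for $i$ odd and $(Y,U^{1:i-1})$ for $i$ even, and let $R$ be the other of these two. Put $$\mathcal F_r=\mathcal L_{U^i}^c\cap\mathcal H_{U^i|S},\quad \mathcal F_d=\mathcal L_{U^i},\quad \mathcal I=\mathcal L_{U^i}^c\cap\mathcal H_{U^i|S}^c,\quad \mathcal I'=\mathcal I\setminus(\mathcal L_{U^i}^c\cap\mathcal L_{U^i|R}).$$ The transmitter draws the bits $v(j)$ of its vector $\bar v^i$ one after the other: uniformly for $j\in\mathcal F_r$, from $P_{V^i(j)|V^i(1:j-1)}$ for $j\in\mathcal F_d$, and from $P_{V^i(j)|V^i(1:j-1),\bar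 S}$ for $j\in\mathcal I$. The receiver's bits agree with the transmitter's for $j\in\mathcal F_r$ (common randomness) and for $j\in\mathcal I'$ (these bits are sent); the receiver draws its other bits, independently of the transmitter, from $P_{V^i(j)|V^i(1:j-1)}$ for $j\in\mathcal F_d$ and from $P_{V^i(j)|V^i(1:j-1),\bar R}$ for $j\in\mathcal I\setminus\mathcal I'$. (If the conditioning event has $P$-probability zero, the bit is drawn uniformly.) Each terminal conditions on its own earlier bits, its own observation and its own versions of the earlier sequences $\bar u^{1},\dots,\bar u^{i-1}$, and obtains its version of $\bar u^i$ as $\bar v^iG_N$. Let $\mathbf U_A^{1:t}$ and $\mathbf U_B^{1:t}$ be the versions of $(\bar u^1,\dots,\bar u^t)$ held by A and B after $t$ rounds. **Proposition.** There is a function $\tilde Z_A^{1:N}$ of $(\bar x,\mathbf u^{1:t})$, evaluated at $(\bar X,\mathbf U_A^{1:t})$, such that for all $0<\beta_7<\beta<1/2$, as $N=2^n\to\infty$, $$\Pr\{\tilde Z_A^{1:N}=f_A(\bar X,\bar Y)\}=1-O(2^{-N^{\beta_7}}),$$ and likewise there is a function $\tilde Z_B^{1:N}$ of $(\bar y,\mathbf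 u^{1:t})$, evaluated at $(\bar Y,\mathbf U_B^{1:t})$, such that for all $0<\beta_7<\beta<1/2$ $$\Pr\{\tilde Z_B^{1:N}=f_B(\bar X,\bar Y)\}=1-O(2^{-N^{\beta_7}}).$$ Here $f_A,f_B$ are applied componentwise, and the constants in $O(\cdot)$ do not depend on $N$. Moreover, $\tilde Z_A^{1:N}$ and $\tilde Z_B^{1:N}$ are computable in time linear in the blocklength $N$ (by a multi-stack Turing machine that does not depend on $N$). -/

import Mathlib

noncomputable section

namespace InteractivePolar

open Matrix

section Probability

variable {Ω 𝒜 ℬ 𝒞 : Type} [Fintype Ω]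

/-- Probability of the event `E` under the mass function `P` on a finite sample space. -/
def prob (P : Ω → ℝ) (E : Set Ω) : ℝ := ∑ ω, E.indicator P ω

/-- Conditional probability of `E` given `C` (zero when `C` has probability zero). -/
def condProb (P : Ω → ℝ) (E C : Set Ω) : ℝ := prob P (E ∩ C) / prob P C

/-- The Markov chain `A → B → C`: given `B`, the variables `A` and `C` are independent. -/
def IsMarkovChain (P : Ω → ℝ) (A : Ω → 𝒜) (B : Ω → ℬ) (C : Ω → 𝒞) : Prop :=
  ∀ a b c, prob P {ω | A ω = a ∧ B ω = b ∧ C ω = c} * prob P {ω | B ω = b} =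
    prob P {ω | A ω = a ∧ B ω = b} * prob P {ω | B ω = b ∧ C ω = c}

/-- Conditional Shannon entropy `H(A | B)` in bits. -/
def condEntropy [Fintype 𝒜] [Fintype ℬ] (P : Ω → ℝ) (A : Ω → 𝒜) (B : Ω → ℬ) : ℝ :=
  ∑ b, prob P {ω | B ω = b} *
    ∑ a, Real.negMulLog (condProb P {ω | A ω = a} {ω | B ω = b}) / Real.log 2

/-- Bhattacharyya parameter `Z(T | B)` of a binary random variable `T` given `B`. -/
def bhattacharyya [Fintype ℬ] (P : Ω → ℝ) (T : Ω → ZMod 2) (B : Ω → ℬ) : ℝ :=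
  2 * ∑ b, prob P {ω | B ω = b} *
    √(condProb P {ω | T ω = 0} {ω | B ω = b} * condProb P {ω | T ω = 1} {ω | B ω = b})

/-- Law of `N` independent copies of a random variable with mass function `P`. -/
def iid (P : Ω → ℝ) (N : ℕ) (ω : Fin N → Ω) : ℝ := ∏ j, P (ω j)

end Probability

section Transform

/-- The kernel `F`. -/
def kernel : Matrix (Fin 2) (Fin 2) (ZMod 2) := !![1, 0; 1, 1]

/-- The `n` binary digits of an index in `{0, …, 2 ^ n - 1}`. -/
def digits (n : ℕ) (i : Fin (2 ^ n)) : Fin n → Fin 2 := finFunctionFinEquiv.symm i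

/-- The Kronecker power `F^{⊗ n}`: an entry is the product of the entries of `F` that are
addressed by the corresponding digits of the row and column indices. -/
def kroneckerPower (n : ℕ) : Matrix (Fin (2 ^ n)) (Fin (2 ^ n)) (ZMod 2) :=
  Matrix.of fun i j => ∏ k, kernel (digits n i k) (digits n j k)

/-- The bit reversal permutation of `{0, …, 2 ^ n - 1}`. -/
def bitReversal (n : ℕ) : Equiv.Perm (Fin (2 ^ n)) :=
  finFunctionFinEquiv.symm.trans
    ((Equiv.arrowCongr Fin.revPerm (Equiv.refl (Fin 2))).trans finFunctionFinEquiv)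

/-- Arikan's transform matrix `G_N = B_N F^{⊗ n}`, `N = 2 ^ n`. -/
def polarMatrix (n : ℕ) : Matrix (Fin (2 ^ n)) (Fin (2 ^ n)) (ZMod 2) :=
  (bitReversal n).permMatrix (ZMod 2) * kroneckerPower n

end Transform

/-- The part of a sequence that precedes index `i`. -/
def past {m : ℕ} {𝒜 : Type} (i : Fin m) (v : Fin m → 𝒜) : Set.Iio i → 𝒜 := fun k => v k

section Round

/-! One round. `P` is the ideal law, `V` the transformed vector of the auxiliary variable of this
round, `S` and `R` the side information of the transmitting and of the receiving terminal, and `δ`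
the polarization threshold. -/

variable {Ω 𝒮 ℛ 𝒲 : Type} [Fintype Ω] [Fintype 𝒮] [Fintype ℛ] [Fintype 𝒲] {N : ℕ}

/-- The index set `ℋ_{·|W}`. -/
def highSet (P : Ω → ℝ) (δ : ℝ) (V : Ω → Fin N → ZMod 2) (W : Ω → 𝒲) : Set (Fin N) :=
  {i | 1 - δ ≤ bhattacharyya P (fun ω => V ω i) (fun ω => (past i (V ω), W ω))}

/-- The index set `ℒ_{·|W}`. -/
def lowSet (P : Ω → ℝ) (δ : ℝ) (V : Ω → Fin N → ZMod 2) (W : Ω → 𝒲) : Set (Fin N) :=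
  {i | bhattacharyya P (fun ω => V ω i) (fun ω => (past i (V ω), W ω)) ≤ δ}

/-- The index set `ℒ` without side information; these are also the near-deterministic
indices `ℱ_d`. -/
def detSet (P : Ω → ℝ) (δ : ℝ) (V : Ω → Fin N → ZMod 2) : Set (Fin N) :=
  lowSet P δ V (fun _ => ())

/-- The random indices `ℱ_r`. -/
def randSet (P : Ω → ℝ) (δ : ℝ) (V : Ω → Fin N → ZMod 2) (S : Ω → 𝒮) : Set (Fin N) :=
  (detSet P δ V)ᶜ ∩ highSet P δ V S

/-- The information indices `ℐ`. -/
def infoSet (P : Ω → ℝ) (δ : ℝ) (V : Ω → Fin N → ZMod 2) (S : Ω → 𝒮) : Set (Fin N) :=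
  (detSet P δ V)ᶜ ∩ (highSet P δ V S)ᶜ

/-- The indices `ℐ'` of the bits that are actually transmitted. -/
def sentSet (P : Ω → ℝ) (δ : ℝ) (V : Ω → Fin N → ZMod 2) (S : Ω → 𝒮) (R : Ω → ℛ) :
    Set (Fin N) :=
  infoSet P δ V S \ ((detSet P δ V)ᶜ ∩ lowSet P δ V R)

open Classical in
/-- The ideal conditional probability that the `j`-th bit of `V` equals `v j`, given that the
earlier bits are those of `v` and that `W = w`. On a conditioning event of probability zero the
bit is, by convention, uniform. -/
def bitLaw (P : Ω → ℝ) (V : Ω → Fin N → ZMod 2) (W : Ω → 𝒲) (j : Fin N)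
    (v : Fin N → ZMod 2) (w : 𝒲) : ℝ :=
  if prob P {ω | past j (V ω) = past j v ∧ W ω = w} = 0 then 1 / 2
  else condProb P {ω | V ω j = v j} {ω | past j (V ω) = past j v ∧ W ω = w}

open Classical in
/-- Probability with which the transmitting terminal, with side information `s`, draws its
`j`-th bit as `vS j` after its earlier bits. -/
def senderBit (P : Ω → ℝ) (δ : ℝ) (V : Ω → Fin N → ZMod 2) (S : Ω → 𝒮) (j : Fin N)
    (vS : Fin N → ZMod 2) (s : 𝒮) : ℝ :=
  if j ∈ randSet P δ V S then 1 / 2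
  else if j ∈ detSet P δ V then bitLaw P V (fun _ => ()) j vS ()
  else bitLaw P V S j vS s

open Classical in
/-- Probability with which the receiving terminal, with side information `r`, obtains its `j`-th
bit as `vR j` after its earlier bits. The bits in `ℱ_r` are common randomness, the bits in `ℐ'`
are received; in both cases the bit is that of the transmitting terminal. The other bits are
drawn independently of the transmitting terminal. -/
def receiverBit (P : Ω → ℝ) (δ : ℝ) (V : Ω → Fin N → ZMod 2) (S : Ω → 𝒮) (R : Ω → ℛ)
    (j : Fin N) (vS vR : Fin N → ZMod 2) (r : ℛ) : ℝ :=
  if j ∈ randSet P δ V S ∪ sentSet P δ V S R then (if vR j = vS j then 1 else 0)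
  else if j ∈ detSet P δ V then bitLaw P V (fun _ => ()) j vR ()
  else bitLaw P V R j vR r

/-- Joint conditional law of the vectors `vS`, `vR` formed in this round by the transmitting and
the receiving terminal, given their side information. -/
def roundLaw (P : Ω → ℝ) (δ : ℝ) (V : Ω → Fin N → ZMod 2) (S : Ω → 𝒮) (R : Ω → ℛ)
    (vS vR : Fin N → ZMod 2) (s : 𝒮) (r : ℛ) : ℝ :=
  ∏ j, senderBit P δ V S j vS s * receiverBit P δ V S R j vS vR r

end Round

section Protocol

variable {X Y : Type} [Fintype X] [Fintype Y] {t : ℕ}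

/-- A value of `(X, Y, U¹, …, Uᵗ)`. -/
abbrev Sample (X Y : Type) (t : ℕ) : Type := X × Y × (Fin t → ZMod 2)

/-- The sequences `ū¹, …, ūᵗ` in a block of `N` samples. -/
def auxSeq {N : ℕ} (ω : Fin N → Sample X Y t) (r : Fin t) : Fin N → ZMod 2 :=
  fun j => (ω j).2.2 r

/-- The vector `v̄ = ū G_N` of round `r` in a block of `N = 2 ^ n` samples. -/
def auxTransform (n : ℕ) (r : Fin t) (ω : Fin (2 ^ n) → Sample X Y t) : Fin (2 ^ n) → ZMod 2 :=
  auxSeq ω r ᵥ* polarMatrix n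

/-- The side information of Terminal A before round `r`: `x̄` and the earlier sequences `ū`. -/
def sideA {N : ℕ} (r : Fin t) (ω : Fin N → Sample X Y t) :
    (Fin N → X) × (Set.Iio r → Fin N → ZMod 2) :=
  (fun j => (ω j).1, past r (auxSeq ω))

/-- The side information of Terminal B before round `r`: `ȳ` and the earlier sequences `ū`. -/
def sideB {N : ℕ} (r : Fin t) (ω : Fin N → Sample X Y t) :
    (Fin N → Y) × (Set.Iio r → Fin N → ZMod 2) :=
  (fun j => (ω j).2.1, past r (auxSeq ω))

/-- An outcome of the protocol: the observations `x̄`, `ȳ` and the vectors `v̄_A`, `v̄_B` formed by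
the two terminals in the `t` rounds. -/
abbrev Outcome (X Y : Type) (t n : ℕ) : Type :=
  (Fin (2 ^ n) → X) × (Fin (2 ^ n) → Y) ×
    (Fin t → Fin (2 ^ n) → ZMod 2) × (Fin t → Fin (2 ^ n) → ZMod 2)

/-- The sequences `ū = v̄ G_N` that a terminal computes from its vectors `v̄`. -/
def decodeAux {n : ℕ} (v : Fin t → Fin (2 ^ n) → ZMod 2) : Fin t → Fin (2 ^ n) → ZMod 2 :=
  fun r => v r ᵥ* polarMatrix n

/-- The threshold `δ_N = 2 ^ (-N ^ β)` at blocklength `N = 2 ^ n`. -/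
def threshold (β : ℝ) (n : ℕ) : ℝ := (2 : ℝ) ^ (-(((2 : ℝ) ^ n) ^ β))

/-- The joint law of an outcome of the `t`-round protocol at blocklength `N = 2 ^ n`, where `P` is
the law of `(X, Y, U¹, …, Uᵗ)`. The rounds are numbered from `0`, so Terminal A transmits in the
rounds of even number. Each terminal uses its own versions of the earlier sequences. -/
def protocolLaw (P : Sample X Y t → ℝ) (β : ℝ) (n : ℕ) : Outcome X Y t n → ℝ :=
  fun o =>
    let x := o.1
    let y := o.2.1
    let vA := o.2.2.1
    let vB := o.2.2.2
    (∏ j, prob P {ω | ω.1 = x j ∧ ω.2.1 = y j}) *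
      ∏ r : Fin t,
        if Even (r : ℕ) then
          roundLaw (iid P (2 ^ n)) (threshold β n) (auxTransform n r) (sideA r) (sideB r)
            (vA r) (vB r) (x, past r (decodeAux vA)) (y, past r (decodeAux vB))
        else
          roundLaw (iid P (2 ^ n)) (threshold β n) (auxTransform n r) (sideB r) (sideA r)
            (vB r) (vA r) (y, past r (decodeAux vB)) (x, past r (decodeAux vA))

end Protocol

section Computation

/-- The input word `x̄ ū¹ … ūᵗ`: the sequences one after the other, every letter marked with the
sequence to which it belongs. -/
def inputWord {𝒳 : Type} {t N : ℕ} (x : Fin N → 𝒳) (u : Fin t → Fin N → ZMod 2) :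
    List (𝒳 ⊕ Fin t × ZMod 2) :=
  List.ofFn (fun j => Sum.inl (x j)) ++
    (List.ofFn fun r => List.ofFn fun j => Sum.inr (r, u r j)).flatten

/-- The family `Z` is computed by a single multi-stack Turing machine, the same for all
blocklengths, in a number of steps that is linear in the blocklength `N`. -/
def ComputableInLinearTime {𝒳 𝒵 : Type} {t : ℕ}
    (Z : (N : ℕ) → (Fin N → 𝒳) → (Fin t → Fin N → ZMod 2) → Fin N → 𝒵) : Prop :=
  ∃ (M : Turing.TM2ComputableAux (𝒳 ⊕ Fin t × ZMod 2) 𝒵) (c : ℕ),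
    ∀ (N : ℕ) (x : Fin N → 𝒳) (u : Fin t → Fin N → ZMod 2),
      Nonempty (Turing.TM2OutputsInTime M.tm
        ((inputWord x u).map M.inputAlphabet.symm)
        (some ((List.ofFn (Z N x u)).map M.outputAlphabet.symm))
        (c * (N + 1)))

end Computation

end InteractivePolar

end

open InteractivePolar

/-!
Let `N = 2 ^ n` and let `P^N` be the law of `N` independent samples. As `f_A` is almost surely a
function `g` of `(X, U¹, …, Uᵗ)`, Terminal A applies `g` letter by letter; this is what
`computableInLinearTime_letterwise` implements on a machine with one stack per sequence. The error
vanishes whenever both terminals obtain the true sequences of a block, so it suffices that the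
protocol does so with probability `1 - O(N √δ_N)`.

The Markov chains and the chain rule factor `P^N(ω)` into the law of `(x̄, ȳ)` and, for every bit
`j` of every round, the conditional law `b` of this bit given the side information of the
transmitting terminal and the preceding bits. The law of the protocol, evaluated at the outcome
where both terminals hold the true vectors of `ω` (`idealOutcome`), has the same shape, with
another factor `a` in place of `b`. Hence it is at least `P^N(ω) (1 - ∑ (1 - a / b)⁺)`
(`iid_mul_one_sub_le_protocolLaw`), and it only remains to bound the expectation under `P^N` of
every single loss `(1 - a / b)⁺` by `2 √δ_N` (`sum_mul_bitLoss_le`):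

* on `ℱ_r` the bit is uniform instead of nearly uniform, which costs a total variation distance of
  at most `√δ_N` since `Z ≥ 1 - δ_N` (`sum_mul_uniform_loss_le`);
* a bit that is guessed by sampling from a conditional law with `Z ≤ δ_N` is wrong with probability
  at most `δ_N` (`sum_mul_one_sub_condProb_le`); there are two such guesses on `ℱ_d` and one on
  `ℐ \ ℐ'`;
* on `ℐ'` nothing is lost.

No polarization is needed, and no joint law of the two terminals has to be compared beyond the ideal
outcomes: these outcomes are distinct for distinct blocks because the polar transform is invertible
(`polarMatrix_mul_self`), and the law of the protocol has total mass one (`sum_protocolLaw`).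
-/

namespace InteractivePolar

/-! ### Conditional probabilities and the Bhattacharyya parameter -/

section ProbabilityBasics

variable {Ω 𝒜 ℬ : Type} [Fintype Ω] {P : Ω → ℝ}

theorem prob_nonneg (hP : ∀ ω, 0 ≤ P ω) (E : Set Ω) : 0 ≤ prob P E :=
  Finset.sum_nonneg fun ω _ => Set.indicator_nonneg (fun ω _ => hP ω) ω

theorem prob_mono (hP : ∀ ω, 0 ≤ P ω) {E C : Set Ω} (h : E ⊆ C) : prob P E ≤ prob P C :=
  Finset.sum_le_sum fun ω _ => Set.indicator_le_indicator_of_subset h hP ω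

theorem le_prob (hP : ∀ ω, 0 ≤ P ω) {E : Set Ω} {ω : Ω} (h : ω ∈ E) : P ω ≤ prob P E := by
  have := Finset.single_le_sum (f := fun ω => E.indicator P ω)
    (fun ω _ => Set.indicator_nonneg (fun ω _ => hP ω) ω) (Finset.mem_univ ω)
  rwa [Set.indicator_of_mem h] at this

theorem prob_pos (hP : ∀ ω, 0 ≤ P ω) {E : Set Ω} {ω : Ω} (h : ω ∈ E) (hω : 0 < P ω) :
    0 < prob P E :=
  hω.trans_le (le_prob hP h)

theorem prob_le_sum (hP : ∀ ω, 0 ≤ P ω) (E : Set Ω) : prob P E ≤ ∑ ω, P ω :=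
  Finset.sum_le_sum fun ω _ => Set.indicator_le_self' (fun ω _ => hP ω) ω

/-- The expectation of a function of `B` is a sum over the values of `B`. -/
theorem sum_mul_comp [Fintype ℬ] (P : Ω → ℝ) (B : Ω → ℬ) (h : ℬ → ℝ) :
    ∑ ω, P ω * h (B ω) = ∑ b, prob P {ω | B ω = b} * h b := by
  classical
  simp only [prob, Finset.sum_mul]
  rw [Finset.sum_comm]
  refine Finset.sum_congr rfl fun ω _ => ?_
  rw [Finset.sum_eq_single (B ω)]
  · simp
  · intro b _ hb
    simp [Set.indicator, hb.symm]
  · simp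

theorem sum_prob_inter [Fintype 𝒜] (P : Ω → ℝ) (A : Ω → 𝒜) (C : Set Ω) :
    ∑ a, prob P ({ω | A ω = a} ∩ C) = prob P C := by
  classical
  have := sum_mul_comp (C.indicator P) A (fun _ => 1)
  simp only [mul_one] at this
  rw [prob, this]
  refine Finset.sum_congr rfl fun a _ => ?_
  simp only [prob, Set.indicator_indicator]

theorem condProb_nonneg (hP : ∀ ω, 0 ≤ P ω) (E C : Set Ω) : 0 ≤ condProb P E C :=
  div_nonneg (prob_nonneg hP _) (prob_nonneg hP _)

theorem condProb_le_one (hP : ∀ ω, 0 ≤ P ω) (E C : Set Ω) : condProb P E C ≤ 1 :=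
  div_le_one_of_le₀ (prob_mono hP Set.inter_subset_right) (prob_nonneg hP _)

theorem condProb_mul_prob (hP : ∀ ω, 0 ≤ P ω) (E C : Set Ω) :
    condProb P E C * prob P C = prob P (E ∩ C) := by
  by_cases h : prob P C = 0
  · have := (prob_mono hP (Set.inter_subset_right : E ∩ C ⊆ C)).trans_eq h
    rw [h, mul_zero, this.antisymm (prob_nonneg hP _)]
  · exact div_mul_cancel₀ _ h

theorem condProb_pos (hP : ∀ ω, 0 ≤ P ω) {E C : Set Ω} {ω : Ω} (hE : ω ∈ E) (hC : ω ∈ C)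
    (hω : 0 < P ω) : 0 < condProb P E C :=
  div_pos (prob_pos hP ⟨hE, hC⟩ hω) (prob_pos hP hC hω)

theorem sum_condProb [Fintype 𝒜] (A : Ω → 𝒜) {C : Set Ω} (hC : prob P C ≠ 0) :
    ∑ a, condProb P {ω | A ω = a} C = 1 := by
  simp only [condProb, ← Finset.sum_div, sum_prob_inter, div_self hC]

theorem sum_zmod_two (f : ZMod 2 → ℝ) : ∑ τ, f τ = f 0 + f 1 :=
  Fin.sum_univ_two f

theorem sum_condProb_zmod (T : Ω → ZMod 2) {C : Set Ω} (hC : prob P C ≠ 0) :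
    condProb P {ω | T ω = 0} C + condProb P {ω | T ω = 1} C = 1 := by
  rw [← sum_condProb T hC, sum_zmod_two]

/-- The expectation of a function of `T` and `B`, by conditioning on `B`. -/
theorem sum_mul_comp_cond [Fintype ℬ] (hP : ∀ ω, 0 ≤ P ω) (T : Ω → ZMod 2) (B : Ω → ℬ)
    (h : ZMod 2 → ℬ → ℝ) :
    ∑ ω, P ω * h (T ω) (B ω) = ∑ b, prob P {ω | B ω = b} *
      (condProb P {ω | T ω = 0} {ω | B ω = b} * h 0 b +
        condProb P {ω | T ω = 1} {ω | B ω = b} * h 1 b) := by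
  classical
  rw [sum_mul_comp P (fun ω => (T ω, B ω)) (fun z => h z.1 z.2), Fintype.sum_prod_type_right]
  refine Finset.sum_congr rfl fun b _ => ?_
  have key : ∀ τ, prob P {ω | (T ω, B ω) = (τ, b)} =
      condProb P {ω | T ω = τ} {ω | B ω = b} * prob P {ω | B ω = b} := fun τ => by
    rw [condProb_mul_prob hP]
    congr 1
    ext ω
    simp
  rw [sum_zmod_two, key, key]
  ring

/-- Guessing a binary `T` by sampling from its conditional law given `B` fails with probability
at most `Z(T | B)`. -/
theorem sum_mul_one_sub_condProb_le [Fintype ℬ] (hP : ∀ ω, 0 ≤ P ω) (T : Ω → ZMod 2)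
    (B : Ω → ℬ) :
    ∑ ω, P ω * (1 - condProb P {ω' | T ω' = T ω} {ω' | B ω' = B ω}) ≤ bhattacharyya P T B := by
  rw [sum_mul_comp_cond hP T B fun τ b => 1 - condProb P {ω' | T ω' = τ} {ω' | B ω' = b},
    bhattacharyya, Finset.mul_sum]
  refine Finset.sum_le_sum fun b _ => ?_
  have h0 := prob_nonneg hP {ω | B ω = b}
  rcases h0.eq_or_lt with h | h
  · simp [← h]
  have hs := sum_condProb_zmod T h.ne'
  set q := condProb P {ω | T ω = 0} {ω | B ω = b}
  have hq : 0 ≤ q := condProb_nonneg hP _ _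
  have hq' : q ≤ 1 := condProb_le_one hP _ _
  obtain h1 : condProb P {ω | T ω = 1} {ω | B ω = b} = 1 - q := by linarith
  rw [h1]
  have hz : 0 ≤ q * (1 - q) := mul_nonneg hq (by linarith)
  have hsq : q * (1 - q) ≤ √(q * (1 - q)) := Real.le_sqrt_of_sq_le
    (pow_le_of_le_one hz (mul_le_one₀ hq' (by linarith) (by linarith)) two_ne_zero)
  nlinarith

/-- A bias `|q - 1/2|` is bounded linearly in the defect `1 - Z`, at the cost of an additive
`η / 2`; linearity is what allows averaging over the side information. -/
theorem abs_sub_half_le {q η : ℝ} (hq : 0 ≤ q) (hq' : q ≤ 1) (hη : 0 < η) :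
    |q - 1 / 2| ≤ η / 2 + (1 - 2 * √(q * (1 - q))) / (4 * η) := by
  set z := √(q * (1 - q))
  have hz : z ^ 2 = q * (1 - q) := Real.sq_sqrt (mul_nonneg hq (by linarith))
  have hd : |q - 1 / 2| ^ 2 = (q - 1 / 2) ^ 2 := sq_abs _
  -- With `d = |q - 1/2|` one has `4 z² = 1 - 4 d²`, hence `2 z ≤ 1 - 2 d²`.
  have h2 : 2 * |q - 1 / 2| ^ 2 ≤ 1 - 2 * z := by nlinarith [sq_nonneg (2 * z - 1)]
  rw [← sub_le_iff_le_add', le_div_iff₀ (by positivity)]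
  nlinarith [sq_nonneg (|q - 1 / 2| - η)]

/-- Drawing uniformly a binary `T` that is nearly uniform given `B` costs, in total variation, at
most the square root of the defect of `Z(T | B)`. -/
theorem sum_mul_uniform_loss_le [Fintype ℬ] (hP : ∀ ω, 0 ≤ P ω) (hP1 : ∑ ω, P ω = 1)
    (T : Ω → ZMod 2) (B : Ω → ℬ) {δ : ℝ} (hδ : 0 < δ) (hZ : 1 - δ ≤ bhattacharyya P T B) :
    ∑ ω, P ω * max 0 (1 - 1 / 2 / condProb P {ω' | T ω' = T ω} {ω' | B ω' = B ω}) ≤ √δ := by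
  -- Apply `abs_sub_half_le` with `η = √δ`, which balances its two terms after averaging.
  have hη : 0 < √δ := Real.sqrt_pos.2 hδ
  have hη2 : √δ ^ 2 = δ := Real.sq_sqrt hδ.le
  rw [sum_mul_comp_cond hP T B fun τ b =>
    max 0 (1 - 1 / 2 / condProb P {ω' | T ω' = τ} {ω' | B ω' = b})]
  have hmax : ∀ q : ℝ, 0 ≤ q → q * max 0 (1 - 1 / 2 / q) = max 0 (q - 1 / 2) := by
    intro q hq
    rcases hq.eq_or_lt with rfl | hq
    · norm_num
    · rw [mul_max_of_nonneg _ _ hq.le, mul_zero, mul_sub, mul_one, mul_div_cancel₀ _ hq.ne']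
  have hb1 : ∑ b, prob P {ω | B ω = b} = 1 := by
    have := sum_mul_comp P B fun _ => 1
    simp only [mul_one] at this
    rw [← this, hP1]
  calc _ ≤ ∑ b, prob P {ω | B ω = b} * (√δ / 2 + (1 - 2 * √(condProb P {ω | T ω = 0}
        {ω | B ω = b} * condProb P {ω | T ω = 1} {ω | B ω = b})) / (4 * √δ)) := by
        refine Finset.sum_le_sum fun b _ => ?_
        have h0 := prob_nonneg hP {ω | B ω = b}
        rcases h0.eq_or_lt with h | h
        · simp [← h]
        refine mul_le_mul_of_nonneg_left ?_ h0
        have hs := sum_condProb_zmod T h.ne'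
        rw [hmax _ (condProb_nonneg hP _ _), hmax _ (condProb_nonneg hP _ _)]
        set q := condProb P {ω | T ω = 0} {ω | B ω = b}
        obtain h1 : condProb P {ω | T ω = 1} {ω | B ω = b} = 1 - q := by linarith
        rw [h1]
        refine le_trans (le_of_eq ?_)
          (abs_sub_half_le (condProb_nonneg hP _ _) (condProb_le_one hP _ _) hη)
        rcases le_total (1 / 2) q with hh | hh
        · rw [abs_of_nonneg (by linarith), max_eq_right (by linarith), max_eq_left (by linarith)]
          ring
        · rw [abs_of_nonpos (by linarith), max_eq_left (by linarith), max_eq_right (by linarith)]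
          ring
    _ = √δ / 2 + (1 - bhattacharyya P T B) / (4 * √δ) := by
        have : ∀ a z : ℝ, a * (√δ / 2 + (1 - 2 * z) / (4 * √δ)) =
            a * (√δ / 2 + 1 / (4 * √δ)) - 2 * (a * z) * (1 / (4 * √δ)) := fun a z => by ring
        simp only [this, Finset.sum_sub_distrib, ← Finset.sum_mul, hb1, ← Finset.mul_sum,
          bhattacharyya]
        ring
    _ ≤ √δ / 2 + δ / (4 * √δ) := by gcongr; linarith
    _ ≤ √δ := by
        have : δ / (4 * √δ) = √δ / 4 := by
          rw [div_eq_div_iff (by positivity) (by norm_num)]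
          linear_combination (-4) * hη2
        rw [this]
        linarith

end ProbabilityBasics

/-! ### The chain rule -/

section ChainRule

variable {Ω 𝒜 𝒲 : Type} [Fintype Ω] {P : Ω → ℝ}

theorem past_eq_past {m : ℕ} {v v' : Fin m → 𝒜} {i : Fin m} :
    past i v = past i v' ↔ ∀ k < i, v k = v' k := by
  simp [past, funext_iff]

/-- Chain rule: the conditional probability of a sequence given `W` is the product of the
conditional probabilities of its entries given `W` and the preceding entries. -/
theorem prod_condProb_past (hP : ∀ ω, 0 ≤ P ω) {m : ℕ} (V : Ω → Fin m → 𝒜) (W : Ω → 𝒲) {ω : Ω}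
    (hω : 0 < P ω) :
    ∏ j, condProb P {ω' | V ω' j = V ω j}
        {ω' | past j (V ω') = past j (V ω) ∧ W ω' = W ω} =
      prob P {ω' | V ω' = V ω ∧ W ω' = W ω} / prob P {ω' | W ω' = W ω} := by
  set A : ℕ → ℝ := fun k => prob P {ω' | (∀ i : Fin m, (i : ℕ) < k → V ω' i = V ω i) ∧ W ω' = W ω}
    with hA
  have hpos : ∀ k, A k ≠ 0 := fun k => (prob_pos hP (ω := ω) (by simp) hω).ne'
  have hstep : ∀ j : Fin m, condProb P {ω' | V ω' j = V ω j}
      {ω' | past j (V ω') = past j (V ω) ∧ W ω' = W ω} = A (j + 1) / A j := by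
    intro j
    rw [condProb]
    congr 2
    · ext ω'
      simp only [past_eq_past, Set.mem_inter_iff, Set.mem_ofPred_eq, Nat.lt_succ_iff]
      constructor
      · rintro ⟨h1, h2, h3⟩
        refine ⟨fun i hi => ?_, h3⟩
        rcases hi.eq_or_lt with h | h
        · rwa [Fin.ext h]
        · exact h2 i h
      · rintro ⟨h1, h2⟩
        exact ⟨h1 j le_rfl, fun k hk => h1 k (le_of_lt hk), h2⟩
    · ext ω'
      simp only [past_eq_past, Set.mem_ofPred_eq, Fin.lt_def]
  have htel : ∀ k, ∏ j ∈ Finset.range k, A (j + 1) / A j = A k / A 0 := by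
    intro k
    induction k with
    | zero => simp [hpos]
    | succ k ih => rw [Finset.prod_range_succ, ih, mul_comm, div_mul_div_cancel₀ (hpos k)]
  rw [Finset.prod_congr rfl fun j _ => hstep j, Fin.prod_univ_eq_prod_range
    (fun j => A (j + 1) / A j), htel]
  simp [hA, funext_iff]

end ChainRule

/-! ### Sequentially drawn sequences -/

section Normalization

variable {𝒜 : Type} [Fintype 𝒜]

open Function in
/-- If each entry of a sequence is drawn from a probability law that depends on the preceding
entries, then the probabilities of all sequences add up to one. -/
theorem sum_prod_kernel [Nonempty 𝒜] {m : ℕ} (a : Fin m → (Fin m → 𝒜) → ℝ)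
    (hdep : ∀ j v v', past j v = past j v' → v j = v' j → a j v = a j v')
    (hsum : ∀ j v, ∑ x, a j (update v j x) = 1) : ∑ v, ∏ j, a j v = 1 := by
  induction m with
  | zero => simp
  | succ m ih =>
    obtain ⟨x₀⟩ := ‹Nonempty 𝒜›
    rw [← (Fin.snocEquiv fun _ => 𝒜).sum_comp, Fintype.sum_prod_type_right]
    simp only [past_eq_past] at hdep
    have hfirst : ∀ (v : Fin m → 𝒜) (x : 𝒜) (j : Fin m),
        a j.castSucc (Fin.snoc v x : Fin (m + 1) → 𝒜) =
          a j.castSucc (Fin.snoc v x₀ : Fin (m + 1) → 𝒜) := by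
      intro v x j
      refine hdep _ _ _ (fun k hk => ?_) (by simp)
      obtain ⟨k, rfl⟩ := Fin.exists_castSucc_eq.2 (ne_of_lt (hk.trans (Fin.castSucc_lt_last j)))
      simp
    have hlast : ∀ v : Fin m → 𝒜,
        ∑ x, a (Fin.last m) (Fin.snoc v x : Fin (m + 1) → 𝒜) = 1 := by
      intro v
      rw [← hsum (Fin.last m) (Fin.snoc v x₀ : Fin (m + 1) → 𝒜)]
      exact Finset.sum_congr rfl fun x _ => congrArg _ (Fin.update_snoc_last ..).symm
    have : ∀ v : Fin m → 𝒜, ∑ x, ∏ j, a j ((Fin.snocEquiv fun _ => 𝒜) (x, v)) =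
        ∏ j : Fin m, a j.castSucc (Fin.snoc v x₀ : Fin (m + 1) → 𝒜) := by
      intro v
      simp only [Fin.prod_univ_castSucc]
      have h : ∀ x, (Fin.snocEquiv fun _ => 𝒜) (x, v) = (Fin.snoc v x : Fin (m + 1) → 𝒜) :=
        fun _ => rfl
      simp only [h, hfirst v]
      rw [← Finset.mul_sum, hlast, mul_one]
    rw [Finset.sum_congr rfl fun v _ => this v]
    refine ih (fun j v => a j.castSucc (Fin.snoc v x₀ : Fin (m + 1) → 𝒜)) ?_ ?_
    · intro j v v' h hj
      rw [past_eq_past] at h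
      refine hdep _ _ _ (fun k hk => ?_) (by simpa using hj)
      obtain ⟨k, rfl⟩ := Fin.exists_castSucc_eq.2 (ne_of_lt (hk.trans (Fin.castSucc_lt_last j)))
      simpa using h k (by simpa using hk)
    · intro j v
      rw [← hsum j.castSucc (Fin.snoc v x₀ : Fin (m + 1) → 𝒜)]
      exact Finset.sum_congr rfl fun x _ => congrArg _ (Fin.snoc_update ..)

end Normalization

/-! ### The transition laws of a round -/

section RoundKernels

open Function

variable {Ω 𝒮 ℛ 𝒲 : Type} [Fintype Ω] [Fintype 𝒮] [Fintype ℛ] {N : ℕ}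
  {P : Ω → ℝ} {δ : ℝ} {V : Ω → Fin N → ZMod 2} {S : Ω → 𝒮} {R : Ω → ℛ} {W : Ω → 𝒲}

theorem past_update {𝒜 : Type} (j : Fin N) (v : Fin N → 𝒜) (x : 𝒜) :
    past j (update v j x) = past j v :=
  past_eq_past.2 fun _ hk => update_of_ne hk.ne _ _

theorem bitLaw_nonneg (hP : ∀ ω, 0 ≤ P ω) (j : Fin N) (v : Fin N → ZMod 2) (w : 𝒲) :
    0 ≤ bitLaw P V W j v w := by
  unfold bitLaw
  split_ifs
  · norm_num
  · exact condProb_nonneg hP _ _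

theorem bitLaw_le_one (hP : ∀ ω, 0 ≤ P ω) (j : Fin N) (v : Fin N → ZMod 2) (w : 𝒲) :
    bitLaw P V W j v w ≤ 1 := by
  unfold bitLaw
  split_ifs
  · norm_num
  · exact condProb_le_one hP _ _

theorem bitLaw_congr {j : Fin N} {v v' : Fin N → ZMod 2} (h : past j v = past j v')
    (hj : v j = v' j) (w : 𝒲) : bitLaw P V W j v w = bitLaw P V W j v' w := by
  simp only [bitLaw, h, hj]

theorem sum_bitLaw (j : Fin N) (v : Fin N → ZMod 2) (w : 𝒲) :
    ∑ x, bitLaw P V W j (update v j x) w = 1 := by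
  simp only [bitLaw, past_update, update_self]
  split_ifs with h
  · rw [sum_zmod_two]
    norm_num
  · exact sum_condProb (fun ω => V ω j) h

/-- On outcomes of positive probability no conditioning event is null. -/
theorem bitLaw_self (hP : ∀ ω, 0 ≤ P ω) {ω : Ω} (hω : 0 < P ω) (j : Fin N) :
    bitLaw P V W j (V ω) (W ω) = condProb P {ω' | V ω' j = V ω j}
      {ω' | past j (V ω') = past j (V ω) ∧ W ω' = W ω} :=
  if_neg (prob_pos hP (ω := ω) (by simp) hω).ne'

theorem bitLaw_self_pos (hP : ∀ ω, 0 ≤ P ω) {ω : Ω} (hω : 0 < P ω) (j : Fin N) :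
    0 < bitLaw P V W j (V ω) (W ω) := by
  rw [bitLaw_self hP hω]
  exact condProb_pos hP (ω := ω) rfl ⟨rfl, rfl⟩ hω

theorem bitLaw_self_eq_condProb_pair (hP : ∀ ω, 0 ≤ P ω) {ω : Ω} (hω : 0 < P ω) (j : Fin N) :
    bitLaw P V W j (V ω) (W ω) = condProb P {ω' | V ω' j = V ω j}
      {ω' | (past j (V ω'), W ω') = (past j (V ω), W ω)} := by
  simp only [bitLaw_self hP hω, Prod.mk.injEq]

theorem senderBit_nonneg (hP : ∀ ω, 0 ≤ P ω) (j : Fin N) (v : Fin N → ZMod 2) (s : 𝒮) :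
    0 ≤ senderBit P δ V S j v s := by
  unfold senderBit
  split_ifs
  exacts [by norm_num, bitLaw_nonneg hP _ _ _, bitLaw_nonneg hP _ _ _]

theorem senderBit_congr {j : Fin N} {v v' : Fin N → ZMod 2} (h : past j v = past j v')
    (hj : v j = v' j) (s : 𝒮) : senderBit P δ V S j v s = senderBit P δ V S j v' s := by
  simp only [senderBit, bitLaw_congr h hj]

theorem sum_senderBit (j : Fin N) (v : Fin N → ZMod 2) (s : 𝒮) :
    ∑ x, senderBit P δ V S j (update v j x) s = 1 := by
  simp only [senderBit]
  split_ifs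
  · rw [sum_zmod_two]
    norm_num
  · exact sum_bitLaw _ _ _
  · exact sum_bitLaw _ _ _

theorem receiverBit_nonneg (hP : ∀ ω, 0 ≤ P ω) (j : Fin N) (vS vR : Fin N → ZMod 2) (r : ℛ) :
    0 ≤ receiverBit P δ V S R j vS vR r := by
  unfold receiverBit
  split_ifs
  exacts [zero_le_one, le_rfl, bitLaw_nonneg hP _ _ _, bitLaw_nonneg hP _ _ _]

theorem receiverBit_congr {j : Fin N} {vS vR vR' : Fin N → ZMod 2} (h : past j vR = past j vR')
    (hj : vR j = vR' j) (r : ℛ) :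
    receiverBit P δ V S R j vS vR r = receiverBit P δ V S R j vS vR' r := by
  simp only [receiverBit, bitLaw_congr h hj, hj]

theorem sum_receiverBit (j : Fin N) (vS vR : Fin N → ZMod 2) (r : ℛ) :
    ∑ x, receiverBit P δ V S R j vS (update vR j x) r = 1 := by
  simp only [receiverBit, update_self]
  split_ifs
  · simp
  · exact sum_bitLaw _ _ _
  · exact sum_bitLaw _ _ _

theorem roundLaw_nonneg (hP : ∀ ω, 0 ≤ P ω) (vS vR : Fin N → ZMod 2) (s : 𝒮) (r : ℛ) :
    0 ≤ roundLaw P δ V S R vS vR s r :=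
  Finset.prod_nonneg fun _ _ => mul_nonneg (senderBit_nonneg hP _ _ _)
    (receiverBit_nonneg hP _ _ _ _)

theorem sum_roundLaw (s : 𝒮) (r : ℛ) :
    ∑ vS, ∑ vR, roundLaw P δ V S R vS vR s r = 1 := by
  simp only [roundLaw, Finset.prod_mul_distrib, ← Finset.mul_sum]
  rw [← sum_prod_kernel (fun j v => senderBit P δ V S j v s)
    (fun j v v' h hj => senderBit_congr h hj s) fun j v => sum_senderBit j v s]
  refine Finset.sum_congr rfl fun vS _ => ?_
  rw [sum_prod_kernel (fun j v => receiverBit P δ V S R j vS v r)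
    (fun j v v' h hj => receiverBit_congr h hj r) fun j v => sum_receiverBit j vS v r, mul_one]

end RoundKernels

/-! ### The loss of a round against the ideal law -/

section RoundLoss

variable {Ω 𝒮 ℛ : Type} [Fintype Ω] [Fintype 𝒮] [Fintype ℛ] {N : ℕ}
  {P : Ω → ℝ} {δ : ℝ} {V : Ω → Fin N → ZMod 2} {S : Ω → 𝒮} {R : Ω → ℛ}

/-- The relative amount by which, at the outcome `ω` of the ideal law, the probability that both
terminals obtain the bit `V ω j` falls short of its ideal conditional probability. -/
noncomputable def bitLoss (P : Ω → ℝ) (δ : ℝ) (V : Ω → Fin N → ZMod 2) (S : Ω → 𝒮) (R : Ω → ℛ) (j : Fin N)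
    (ω : Ω) : ℝ :=
  max 0 (1 - senderBit P δ V S j (V ω) (S ω) * receiverBit P δ V S R j (V ω) (V ω) (R ω) /
    bitLaw P V S j (V ω) (S ω))

theorem bitLoss_nonneg (j : Fin N) (ω : Ω) : 0 ≤ bitLoss P δ V S R j ω :=
  le_max_left _ _

theorem bitLoss_le_one (hP : ∀ ω, 0 ≤ P ω) (j : Fin N) (ω : Ω) : bitLoss P δ V S R j ω ≤ 1 :=
  max_le zero_le_one <| sub_le_self _ <| div_nonneg
    (mul_nonneg (senderBit_nonneg hP _ _ _) (receiverBit_nonneg hP _ _ _ _)) (bitLaw_nonneg hP _ _ _)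

/-- The expected loss at an index is small, whichever part of the index set it belongs to. -/
theorem sum_mul_bitLoss_le (hP : ∀ ω, 0 ≤ P ω) (hP1 : ∑ ω, P ω = 1) (hδ : 0 < δ) (hδ1 : δ ≤ 1)
    (j : Fin N) : ∑ ω, P ω * bitLoss P δ V S R j ω ≤ 2 * √δ := by
  have hsqrt : δ ≤ √δ := Real.le_sqrt_of_sq_le (pow_le_of_le_one hδ.le hδ1 two_ne_zero)
  have hterm : ∀ f : Ω → ℝ, (∀ ω, 0 < P ω → bitLoss P δ V S R j ω ≤ f ω) →
      ∑ ω, P ω * bitLoss P δ V S R j ω ≤ ∑ ω, P ω * f ω := by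
    intro f hf
    refine Finset.sum_le_sum fun ω _ => ?_
    rcases (hP ω).eq_or_lt with h | h
    · simp [← h]
    · exact mul_le_mul_of_nonneg_left (hf ω h) h.le
  by_cases hr : j ∈ randSet P δ V S
  · -- The bit is drawn uniformly and shared, and it is nearly uniform given `S` and the past.
    refine (hterm _ fun ω hω => ?_).trans ((sum_mul_uniform_loss_le hP hP1 (fun ω => V ω j)
      (fun ω => (past j (V ω), S ω)) hδ hr.2).trans (by linarith [Real.sqrt_nonneg δ]))
    rw [bitLoss, bitLaw_self_eq_condProb_pair hP hω, senderBit, receiverBit, if_pos hr,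
      if_pos (Set.mem_union_left _ hr), if_pos rfl, mul_one]
  by_cases hd : j ∈ detSet P δ V
  · -- Both terminals guess the bit from the past alone; each fails with probability at most `δ`.
    have hs : j ∉ sentSet P δ V S R := fun h => h.1.1 hd
    have hZ := sum_mul_one_sub_condProb_le hP (fun ω => V ω j) (fun ω => (past j (V ω), ()))
    refine (hterm (fun ω => 2 * (1 - condProb P {ω' | V ω' j = V ω j}
      {ω' | (past j (V ω'), ()) = (past j (V ω), ())})) fun ω hω => ?_).trans ?_
    · rw [bitLoss, senderBit, receiverBit, if_neg hr, if_pos hd, if_neg (by simp [hr, hs]),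
        if_pos hd, ← bitLaw_self_eq_condProb_pair (W := fun _ => ()) hP hω]
      set c := bitLaw P V (fun _ => ()) j (V ω) ()
      have hc : 0 ≤ c := bitLaw_nonneg hP _ _ _
      have hc1 : c ≤ 1 := bitLaw_le_one hP _ _ _
      refine max_le (by linarith) ?_
      have : c * c ≤ c * c / bitLaw P V S j (V ω) (S ω) :=
        le_div_self (mul_nonneg hc hc) (bitLaw_self_pos hP hω j) (bitLaw_le_one hP _ _ _)
      nlinarith [sq_nonneg (1 - c)]
    · have : ∀ f : Ω → ℝ, ∑ ω, P ω * (2 * f ω) = 2 * ∑ ω, P ω * f ω := fun f => by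
        rw [Finset.mul_sum]
        exact Finset.sum_congr rfl fun _ _ => by ring
      rw [this]
      have hd' : bhattacharyya P (fun ω => V ω j) (fun ω => (past j (V ω), ())) ≤ δ := hd
      linarith
  by_cases hs : j ∈ sentSet P δ V S R
  · -- The bit is drawn from its exact law and sent.
    refine (hterm (fun _ => 0) fun ω hω => ?_).trans (by simp)
    rw [bitLoss, senderBit, receiverBit, if_neg hr, if_neg hd, if_pos (Set.mem_union_right _ hs), if_pos rfl,
      mul_one, div_self (bitLaw_self_pos hP hω j).ne']
    simp
  · -- The bit is drawn from its exact law, and the receiver guesses it from `R` and the past.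
    have hR : j ∈ lowSet P δ V R := by
      by_contra h
      exact hs ⟨⟨hd, fun hh => hr ⟨hd, hh⟩⟩, fun hh => h hh.2⟩
    refine (hterm _ fun ω hω => ?_).trans ((sum_mul_one_sub_condProb_le hP (fun ω => V ω j)
      (fun ω => (past j (V ω), R ω))).trans (le_trans hR (by linarith)))
    rw [bitLoss, senderBit, receiverBit, if_neg hr, if_neg hd, if_neg (by simp [hr, hs]),
      if_neg hd, ← bitLaw_self_eq_condProb_pair (W := R) hP hω,
      mul_div_cancel_left₀ _ (bitLaw_self_pos hP hω j).ne']
    exact max_le (by linarith [bitLaw_le_one (V := V) (W := R) hP j (V ω) (R ω)]) le_rfl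

/-- At an outcome of the ideal law, the probability that both terminals obtain the ideal vector is
the ideal conditional probability up to the losses of the single bits. -/
theorem mul_prod_one_sub_bitLoss_le_roundLaw (hP : ∀ ω, 0 ≤ P ω) {ω : Ω} (hω : 0 < P ω) :
    prob P {ω' | V ω' = V ω ∧ S ω' = S ω} / prob P {ω' | S ω' = S ω} *
      ∏ j, (1 - bitLoss P δ V S R j ω) ≤ roundLaw P δ V S R (V ω) (V ω) (S ω) (R ω) := by
  rw [← prod_condProb_past hP V S hω, ← Finset.prod_mul_distrib]
  refine Finset.prod_le_prod (fun j _ => mul_nonneg (condProb_nonneg hP _ _)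
    (sub_nonneg.2 (bitLoss_le_one hP j ω))) fun j _ => ?_
  rw [← bitLaw_self hP hω]
  have hb := bitLaw_self_pos (V := V) (W := S) hP hω j
  refine (mul_le_mul_of_nonneg_left (sub_le_sub_left (le_max_right _ _) 1) hb.le).trans_eq ?_
  rw [sub_sub_cancel, mul_div_cancel₀ _ hb.ne']

end RoundLoss

/-! ### Independent copies -/

section Products

variable {Ω : Type}

theorem iid_nonneg {P : Ω → ℝ} (hP : ∀ ω, 0 ≤ P ω) (N : ℕ) (ω : Fin N → Ω) : 0 ≤ iid P N ω :=
  Finset.prod_nonneg fun _ _ => hP _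

theorem sum_iid [Fintype Ω] {P : Ω → ℝ} (hP1 : ∑ ω, P ω = 1) (N : ℕ) : ∑ ω, iid P N ω = 1 := by
  have := Finset.prod_univ_sum (fun _ : Fin N => (Finset.univ : Finset Ω)) fun _ => P
  simp only [hP1, Finset.prod_const_one, Fintype.piFinset_univ] at this
  exact this.symm

/-- Under the law of independent copies, a product event has the product probability. -/
theorem prob_iid [Fintype Ω] (P : Ω → ℝ) {N : ℕ} (E : Fin N → Set Ω) :
    prob (iid P N) {ω | ∀ j, ω j ∈ E j} = ∏ j, prob P (E j) := by
  classical
  simp only [prob]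
  rw [Finset.prod_univ_sum, Fintype.piFinset_univ]
  refine Finset.sum_congr rfl fun ω _ => ?_
  by_cases h : ∀ j, ω j ∈ E j
  · rw [Set.indicator_of_mem (s := {ω : Fin N → Ω | ∀ j, ω j ∈ E j}) h]
    exact Finset.prod_congr rfl fun j _ => (Set.indicator_of_mem (h j) P).symm
  · rw [Set.indicator_of_notMem (s := {ω : Fin N → Ω | ∀ j, ω j ∈ E j}) h]
    obtain ⟨j, hj⟩ := not_forall.1 h
    exact (Finset.prod_eq_zero (Finset.mem_univ j) (Set.indicator_of_notMem hj P)).symm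

theorem one_sub_sum_le_prod_one_sub {ι : Type} (s : Finset ι) {f : ι → ℝ}
    (h0 : ∀ i ∈ s, 0 ≤ f i) (h1 : ∀ i ∈ s, f i ≤ 1) :
    1 - ∑ i ∈ s, f i ≤ ∏ i ∈ s, (1 - f i) := by
  classical
  induction s using Finset.induction_on with
  | empty => simp
  | insert i s hi ih =>
    rw [Finset.sum_insert hi, Finset.prod_insert hi]
    have h := ih (fun k hk => h0 k (Finset.mem_insert_of_mem hk))
      fun k hk => h1 k (Finset.mem_insert_of_mem hk)
    have hi0 := h0 i (Finset.mem_insert_self i s)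
    have hi1 := h1 i (Finset.mem_insert_self i s)
    have hs : 0 ≤ ∑ k ∈ s, f k :=
      Finset.sum_nonneg fun k hk => h0 k (Finset.mem_insert_of_mem hk)
    nlinarith [mul_le_mul_of_nonneg_left h (sub_nonneg.2 hi1), mul_nonneg hi0 hs]

end Products

/-! ### The polar transform is an involution -/

section TransformInvolution

open Matrix

theorem kernel_mul_self : kernel * kernel = 1 := by
  decide

theorem kroneckerPower_mul_self (n : ℕ) : kroneckerPower n * kroneckerPower n = 1 := by
  ext i j
  simp only [mul_apply, kroneckerPower, of_apply, ← Finset.prod_mul_distrib]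
  have hsum := (finFunctionFinEquiv (m := 2) (n := n)).symm.sum_comp fun d =>
    ∏ k, kernel (digits n i k) (d k) * kernel (d k) (digits n j k)
  have hprod := Finset.prod_univ_sum (fun _ : Fin n => (Finset.univ : Finset (Fin 2)))
    fun k d => kernel (digits n i k) d * kernel d (digits n j k)
  rw [Fintype.piFinset_univ] at hprod
  refine hsum.trans (hprod.symm.trans ?_)
  simp only [← mul_apply, kernel_mul_self, one_apply, Finset.prod_ite_zero, Finset.prod_const_one,
    Finset.mem_univ, true_implies]
  have : (∀ k, digits n i k = digits n j k) ↔ i = j := by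
    rw [← funext_iff]
    exact (finFunctionFinEquiv (m := 2) (n := n)).symm.injective.eq_iff
  simp only [this]

theorem digits_bitReversal (n : ℕ) (i : Fin (2 ^ n)) (k : Fin n) :
    digits n (bitReversal n i) k = digits n i k.rev := by
  simp [digits, bitReversal, Equiv.arrowCongr]

theorem bitReversal_bitReversal (n : ℕ) (i : Fin (2 ^ n)) :
    bitReversal n (bitReversal n i) = i :=
  (finFunctionFinEquiv (m := 2) (n := n)).symm.injective <| funext fun k => by
    change digits n _ k = digits n _ k
    simp [digits_bitReversal]

theorem kroneckerPower_bitReversal (n : ℕ) (i j : Fin (2 ^ n)) :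
    kroneckerPower n (bitReversal n i) (bitReversal n j) = kroneckerPower n i j := by
  simp only [kroneckerPower, of_apply, digits_bitReversal]
  exact Equiv.prod_comp Fin.revPerm fun k => kernel (digits n i k) (digits n j k)

/-- The polar transform is an involution, as `F ^ 2 = 1` and the bit reversal commutes with
`F^{⊗ n}`. -/
theorem polarMatrix_mul_self (n : ℕ) : polarMatrix n * polarMatrix n = 1 := by
  have hB : ∀ i j, polarMatrix n i j = kroneckerPower n (bitReversal n i) j := fun i j => by
    rw [polarMatrix, PEquiv.toMatrix_toPEquiv_mul]
    rfl
  have hK := kroneckerPower_mul_self n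
  ext i j
  simp only [mul_apply, hB]
  rw [← bitReversal_bitReversal n j]
  simp only [kroneckerPower_bitReversal]
  rw [← mul_apply, hK]
  simp only [one_apply, (bitReversal n).injective.eq_iff, bitReversal_bitReversal]

end TransformInvolution

/-! ### Ideal outcomes -/

section IdealOutcome

variable {X Y : Type} {t : ℕ}

/-- The outcome in which both terminals obtain the vectors of the block `ω` of samples. -/
def idealOutcome (n : ℕ) (ω : Fin (2 ^ n) → Sample X Y t) : Outcome X Y t n :=
  (fun j => (ω j).1, fun j => (ω j).2.1, fun r => auxTransform n r ω,
    fun r => auxTransform n r ω)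

theorem decodeAux_auxTransform (n : ℕ) (ω : Fin (2 ^ n) → Sample X Y t) :
    decodeAux (fun r => auxTransform n r ω) = auxSeq ω := by
  funext r
  simp [decodeAux, auxTransform, Matrix.vecMul_vecMul, polarMatrix_mul_self]

theorem idealOutcome_injective (n : ℕ) :
    Function.Injective (idealOutcome n : (Fin (2 ^ n) → Sample X Y t) → Outcome X Y t n) := by
  intro ω ω' h
  simp only [idealOutcome, Prod.mk.injEq] at h
  obtain ⟨hx, hy, hv, -⟩ := h
  have hu : auxSeq ω = auxSeq ω' := by
    rw [← decodeAux_auxTransform n ω, hv, decodeAux_auxTransform]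
  funext j
  exact Prod.ext (congrFun hx j) (Prod.ext (congrFun hy j) (funext fun r =>
    congrFun (congrFun hu r) j))

theorem auxTransform_eq_iff {n : ℕ} {r : Fin t} {ω ω' : Fin (2 ^ n) → Sample X Y t} :
    auxTransform n r ω = auxTransform n r ω' ↔ ∀ j, (ω j).2.2 r = (ω' j).2.2 r := by
  constructor
  · intro h j
    have := congrArg (fun v => Matrix.vecMul v (polarMatrix n)) h
    simp only [auxTransform, Matrix.vecMul_vecMul, polarMatrix_mul_self, Matrix.vecMul_one] at this
    exact congrFun this j
  · intro h
    have : auxSeq ω r = auxSeq ω' r := funext h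
    rw [auxTransform, this, auxTransform]

theorem sideA_eq_iff {N : ℕ} {r : Fin t} {ω ω' : Fin N → Sample X Y t} :
    sideA r ω = sideA r ω' ↔
      ∀ j, ((ω j).1, past r (ω j).2.2) = ((ω' j).1, past r (ω' j).2.2) := by
  simp only [sideA, Prod.mk.injEq, past, auxSeq, funext_iff, forall_and]
  exact and_congr_right fun _ => forall_comm

theorem sideB_eq_iff {N : ℕ} {r : Fin t} {ω ω' : Fin N → Sample X Y t} :
    sideB r ω = sideB r ω' ↔
      ∀ j, ((ω j).2.1, past r (ω j).2.2) = ((ω' j).2.1, past r (ω' j).2.2) := by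
  simp only [sideB, Prod.mk.injEq, past, auxSeq, funext_iff, forall_and]
  exact and_congr_right fun _ => forall_comm

end IdealOutcome

/-! ### Factorization of the ideal law along the rounds -/

section Factorization

theorem condProb_eq_of_isMarkovChain {Ω 𝒜 ℬ 𝒞 : Type} [Fintype Ω] {P : Ω → ℝ}
    (hP : ∀ ω, 0 ≤ P ω) {A : Ω → 𝒜} {B : Ω → ℬ} {C : Ω → 𝒞} (h : IsMarkovChain P A B C) {ω : Ω}
    (hω : 0 < P ω) :
    condProb P {ω' | A ω' = A ω} {ω' | B ω' = B ω ∧ C ω' = C ω} =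
      prob P {ω' | A ω' = A ω ∧ B ω' = B ω} / prob P {ω' | B ω' = B ω} := by
  have h1 : prob P {ω' | B ω' = B ω} ≠ 0 := (prob_pos hP (ω := ω) (by simp) hω).ne'
  have h2 : prob P {ω' | B ω' = B ω ∧ C ω' = C ω} ≠ 0 := (prob_pos hP (ω := ω) (by simp) hω).ne'
  rw [condProb, div_eq_div_iff h2 h1]
  exact h _ _ _

variable {X Y : Type} [Fintype X] [Fintype Y] {t : ℕ} {P : Sample X Y t → ℝ}

/-- The conditional probability, given the side information of the transmitting terminal, of the
letter of round `r` of the sample `z`. -/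
noncomputable def letterLaw (P : Sample X Y t → ℝ) (r : Fin t) (z : Sample X Y t) : ℝ :=
  if Even (r : ℕ) then
    prob P {ω | ω.2.2 r = z.2.2 r ∧ (ω.1, past r ω.2.2) = (z.1, past r z.2.2)} /
      prob P {ω | (ω.1, past r ω.2.2) = (z.1, past r z.2.2)}
  else
    prob P {ω | ω.2.2 r = z.2.2 r ∧ (ω.2.1, past r ω.2.2) = (z.2.1, past r z.2.2)} /
      prob P {ω | (ω.2.1, past r ω.2.2) = (z.2.1, past r z.2.2)}

/-- The Markov chains factor the law of a single sample in the order of the protocol. -/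
theorem eq_prob_mul_prod_letterLaw (hP : ∀ ω, 0 ≤ P ω)
    (hA : ∀ r : Fin t, Even (r : ℕ) →
      IsMarkovChain P (fun ω => ω.2.2 r) (fun ω => (ω.1, past r ω.2.2)) (fun ω => ω.2.1))
    (hB : ∀ r : Fin t, Odd (r : ℕ) →
      IsMarkovChain P (fun ω => ω.2.2 r) (fun ω => (ω.2.1, past r ω.2.2)) (fun ω => ω.1))
    {z : Sample X Y t} (hz : 0 < P z) :
    P z = prob P {ω | ω.1 = z.1 ∧ ω.2.1 = z.2.1} * ∏ r, letterLaw P r z := by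
  classical
  have hchain := prod_condProb_past hP (fun ω : Sample X Y t => ω.2.2)
    (fun ω => (ω.1, ω.2.1)) hz
  have hz' : prob P {ω | ω.2.2 = z.2.2 ∧ (ω.1, ω.2.1) = (z.1, z.2.1)} = P z := by
    have : {ω : Sample X Y t | ω.2.2 = z.2.2 ∧ (ω.1, ω.2.1) = (z.1, z.2.1)} = {z} := by
      ext ω
      simp only [Set.mem_ofPred_eq, Set.mem_singleton_iff, Prod.ext_iff]
      tauto
    rw [this, prob, Finset.sum_eq_single z]
    · simp
    · intro b _ hb
      simp [hb]
    · simp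
  have hletter : ∀ r : Fin t, letterLaw P r z = condProb P {ω | ω.2.2 r = z.2.2 r}
      {ω | past r ω.2.2 = past r z.2.2 ∧ (ω.1, ω.2.1) = (z.1, z.2.1)} := by
    intro r
    unfold letterLaw
    split_ifs with hr
    · rw [← condProb_eq_of_isMarkovChain hP (hA r hr) hz]
      congr 1
      ext ω
      simp only [Prod.mk.injEq, Set.mem_ofPred_eq]
      tauto
    · rw [← condProb_eq_of_isMarkovChain hP (hB r (Nat.not_even_iff_odd.1 hr)) hz]
      congr 1
      ext ω
      simp only [Prod.mk.injEq, Set.mem_ofPred_eq]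
      tauto
  have hxy : prob P {ω | ω.1 = z.1 ∧ ω.2.1 = z.2.1} ≠ 0 :=
    (prob_pos hP (ω := z) (by simp) hz).ne'
  simp only [hletter]
  rw [hchain, hz']
  simp only [Prod.mk.injEq]
  rw [mul_div_cancel₀ _ hxy]

/-- The conditional probability, given the side information of the transmitting terminal, of the
vector of round `r` is the product of those of its letters. -/
theorem prod_letterLaw (P : Sample X Y t → ℝ) (n : ℕ) (r : Fin t)
    (ω : Fin (2 ^ n) → Sample X Y t) :
    ∏ j, letterLaw P r (ω j) =
      if Even (r : ℕ) then
        prob (iid P (2 ^ n)) {ω' | auxTransform n r ω' = auxTransform n r ω ∧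
          sideA r ω' = sideA r ω} / prob (iid P (2 ^ n)) {ω' | sideA r ω' = sideA r ω}
      else
        prob (iid P (2 ^ n)) {ω' | auxTransform n r ω' = auxTransform n r ω ∧
          sideB r ω' = sideB r ω} / prob (iid P (2 ^ n)) {ω' | sideB r ω' = sideB r ω} := by
  unfold letterLaw
  split_ifs
  · rw [Finset.prod_div_distrib, ← prob_iid, ← prob_iid]
    simp only [auxTransform_eq_iff, sideA_eq_iff, ← forall_and, Set.mem_ofPred_eq]
  · rw [Finset.prod_div_distrib, ← prob_iid, ← prob_iid]
    simp only [auxTransform_eq_iff, sideB_eq_iff, ← forall_and, Set.mem_ofPred_eq]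

end Factorization

/-! ### The law of the protocol -/

section ProtocolLaw

variable {X Y : Type} [Fintype X] [Fintype Y] {t : ℕ} {P : Sample X Y t → ℝ} {β : ℝ} {n : ℕ}

theorem protocolLaw_nonneg (hP : ∀ ω, 0 ≤ P ω) (o : Outcome X Y t n) :
    0 ≤ protocolLaw P β n o := by
  refine mul_nonneg (Finset.prod_nonneg fun _ _ => prob_nonneg hP _)
    (Finset.prod_nonneg fun r _ => ?_)
  split_ifs
  · exact roundLaw_nonneg (iid_nonneg hP _) _ _ _ _
  · exact roundLaw_nonneg (iid_nonneg hP _) _ _ _ _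

open Function in
theorem sum_protocolLaw (hP1 : ∑ ω, P ω = 1) :
    ∑ o, protocolLaw P β n o = 1 := by
  classical
  have hrounds : ∀ (x : Fin (2 ^ n) → X) (y : Fin (2 ^ n) → Y),
      ∑ vA, ∑ vB, protocolLaw P β n (x, y, vA, vB) =
        ∏ j, prob P {ω | ω.1 = x j ∧ ω.2.1 = y j} := by
    intro x y
    simp only [protocolLaw, ← Finset.mul_sum]
    rw [← Fintype.sum_prod_type', ← (Equiv.arrowProdEquivProdArrow (Fin t)
      (fun _ => Fin (2 ^ n) → ZMod 2) (fun _ => Fin (2 ^ n) → ZMod 2)).sum_comp]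
    simp only [Equiv.arrowProdEquivProdArrow_apply]
    rw [sum_prod_kernel (𝒜 := (Fin (2 ^ n) → ZMod 2) × (Fin (2 ^ n) → ZMod 2)), mul_one]
    · intro r v v' h hr
      have h1 : past r (decodeAux fun k => (v k).1) = past r (decodeAux fun k => (v' k).1) := by
        rw [past_eq_past] at h ⊢
        exact fun k hk => by simp only [decodeAux, h k hk]
      have h2 : past r (decodeAux fun k => (v k).2) = past r (decodeAux fun k => (v' k).2) := by
        rw [past_eq_past] at h ⊢
        exact fun k hk => by simp only [decodeAux, h k hk]
      simp only [h1, h2, hr]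
    · intro r v
      have h1 : ∀ z, past r (decodeAux fun k => (update v r z k).1) =
          past r (decodeAux fun k => (v k).1) := fun z =>
        past_eq_past.2 fun k hk => by simp only [decodeAux, update_of_ne hk.ne]
      have h2 : ∀ z, past r (decodeAux fun k => (update v r z k).2) =
          past r (decodeAux fun k => (v k).2) := fun z =>
        past_eq_past.2 fun k hk => by simp only [decodeAux, update_of_ne hk.ne]
      simp only [h1, h2, update_self]
      split_ifs
      · rw [Fintype.sum_prod_type]
        exact sum_roundLaw _ _
      · rw [Fintype.sum_prod_type_right]
        exact sum_roundLaw _ _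
  simp only [Fintype.sum_prod_type]
  simp only [hrounds]
  rw [← Fintype.sum_prod_type', ← (Equiv.arrowProdEquivProdArrow (Fin (2 ^ n))
    (fun _ => X) (fun _ => Y)).sum_comp]
  have := Finset.prod_univ_sum (fun _ : Fin (2 ^ n) => (Finset.univ : Finset (X × Y)))
    fun _ z => prob P {ω | ω.1 = z.1 ∧ ω.2.1 = z.2}
  rw [Fintype.piFinset_univ] at this
  refine this.symm.trans (Finset.prod_eq_one fun _ _ => ?_)
  have h := sum_mul_comp P (fun ω => (ω.1, ω.2.1)) fun _ => 1
  simp only [mul_one, hP1, Prod.ext_iff] at h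
  exact h.symm

/-- The loss of the bit `j` of round `r`. -/
noncomputable def protocolLoss (P : Sample X Y t → ℝ) (β : ℝ) (n : ℕ) (r : Fin t)
    (j : Fin (2 ^ n)) (ω : Fin (2 ^ n) → Sample X Y t) : ℝ :=
  if Even (r : ℕ) then
    bitLoss (iid P (2 ^ n)) (threshold β n) (auxTransform n r) (sideA r) (sideB r) j ω
  else
    bitLoss (iid P (2 ^ n)) (threshold β n) (auxTransform n r) (sideB r) (sideA r) j ω

theorem protocolLoss_nonneg (r : Fin t) (j : Fin (2 ^ n)) (ω : Fin (2 ^ n) → Sample X Y t) :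
    0 ≤ protocolLoss P β n r j ω := by
  unfold protocolLoss
  split_ifs
  exacts [bitLoss_nonneg _ _, bitLoss_nonneg _ _]

theorem protocolLoss_le_one (hP : ∀ ω, 0 ≤ P ω) (r : Fin t) (j : Fin (2 ^ n))
    (ω : Fin (2 ^ n) → Sample X Y t) : protocolLoss P β n r j ω ≤ 1 := by
  unfold protocolLoss
  split_ifs
  exacts [bitLoss_le_one (iid_nonneg hP _) _ _, bitLoss_le_one (iid_nonneg hP _) _ _]

theorem threshold_pos : 0 < threshold β n := by
  unfold threshold
  positivity

theorem threshold_le_one : threshold β n ≤ 1 :=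
  Real.rpow_le_one_of_one_le_of_nonpos one_le_two (neg_nonpos.2 (by positivity))

theorem sum_mul_protocolLoss_le (hP : ∀ ω, 0 ≤ P ω) (hP1 : ∑ ω, P ω = 1) (r : Fin t)
    (j : Fin (2 ^ n)) :
    ∑ ω, iid P (2 ^ n) ω * protocolLoss P β n r j ω ≤ 2 * √(threshold β n) := by
  unfold protocolLoss
  split_ifs
  · exact sum_mul_bitLoss_le (iid_nonneg hP _) (sum_iid hP1 _) threshold_pos threshold_le_one j
  · exact sum_mul_bitLoss_le (iid_nonneg hP _) (sum_iid hP1 _) threshold_pos threshold_le_one j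

/-- The protocol produces every ideal outcome with nearly its ideal probability. -/
theorem iid_mul_one_sub_le_protocolLaw (hP : ∀ ω, 0 ≤ P ω)
    (hA : ∀ r : Fin t, Even (r : ℕ) →
      IsMarkovChain P (fun ω => ω.2.2 r) (fun ω => (ω.1, past r ω.2.2)) (fun ω => ω.2.1))
    (hB : ∀ r : Fin t, Odd (r : ℕ) →
      IsMarkovChain P (fun ω => ω.2.2 r) (fun ω => (ω.2.1, past r ω.2.2)) (fun ω => ω.1))
    {ω : Fin (2 ^ n) → Sample X Y t} (hω : 0 < iid P (2 ^ n) ω) :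
    iid P (2 ^ n) ω * (1 - ∑ r, ∑ j, protocolLoss P β n r j ω) ≤
      protocolLaw P β n (idealOutcome n ω) := by
  have hpos : ∀ j, 0 < P (ω j) := fun j => (hP _).lt_of_ne' fun h =>
    hω.ne' (Finset.prod_eq_zero (Finset.mem_univ j) h)
  have hloss : 1 - ∑ r, ∑ j, protocolLoss P β n r j ω ≤
      ∏ r, ∏ j, (1 - protocolLoss P β n r j ω) := by
    rw [← Fintype.sum_prod_type', ← Fintype.prod_prod_type']
    exact one_sub_sum_le_prod_one_sub _ (fun _ _ => protocolLoss_nonneg _ _ _)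
      fun _ _ => protocolLoss_le_one hP _ _ _
  refine (mul_le_mul_of_nonneg_left hloss hω.le).trans ?_
  have hfactor : iid P (2 ^ n) ω = (∏ j, prob P {z | z.1 = (ω j).1 ∧ z.2.1 = (ω j).2.1}) *
      ∏ r, ∏ j, letterLaw P r (ω j) := by
    rw [iid, Finset.prod_comm, ← Finset.prod_mul_distrib]
    exact Finset.prod_congr rfl fun j _ => eq_prob_mul_prod_letterLaw hP hA hB (hpos j)
  rw [hfactor, mul_assoc, ← Finset.prod_mul_distrib]
  refine mul_le_mul_of_nonneg_left ?_ (Finset.prod_nonneg fun _ _ => prob_nonneg hP _)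
  simp only [idealOutcome, decodeAux_auxTransform]
  refine Finset.prod_le_prod (fun r _ => mul_nonneg (Finset.prod_nonneg fun j _ => ?_)
    (Finset.prod_nonneg fun j _ => sub_nonneg.2 (protocolLoss_le_one hP _ _ _))) fun r _ => ?_
  · unfold letterLaw
    split_ifs
    exacts [div_nonneg (prob_nonneg hP _) (prob_nonneg hP _),
      div_nonneg (prob_nonneg hP _) (prob_nonneg hP _)]
  · rw [prod_letterLaw]
    unfold protocolLoss
    split_ifs
    · exact mul_prod_one_sub_bitLoss_le_roundLaw (iid_nonneg hP _) hω
    · exact mul_prod_one_sub_bitLoss_le_roundLaw (iid_nonneg hP _) hω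

/-- An event that contains all ideal outcomes fails under the law of the protocol with small
probability. -/
theorem abs_one_sub_prob_protocolLaw_le (hP : ∀ ω, 0 ≤ P ω) (hP1 : ∑ ω, P ω = 1)
    (hA : ∀ r : Fin t, Even (r : ℕ) →
      IsMarkovChain P (fun ω => ω.2.2 r) (fun ω => (ω.1, past r ω.2.2)) (fun ω => ω.2.1))
    (hB : ∀ r : Fin t, Odd (r : ℕ) →
      IsMarkovChain P (fun ω => ω.2.2 r) (fun ω => (ω.2.1, past r ω.2.2)) (fun ω => ω.1))
    {E : Set (Outcome X Y t n)} (hE : ∀ ω, 0 < iid P (2 ^ n) ω → idealOutcome n ω ∈ E) :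
    |1 - prob (protocolLaw P β n) E| ≤ 2 * t * (2 ^ n * √(threshold β n)) := by
  classical
  have hL : ∀ o, 0 ≤ protocolLaw P β n o := protocolLaw_nonneg hP
  have hle : prob (protocolLaw P β n) E ≤ 1 := (prob_le_sum hL E).trans_eq (sum_protocolLaw hP1)
  rw [abs_of_nonneg (sub_nonneg.2 hle), sub_le_comm]
  have hsum : ∑ ω, iid P (2 ^ n) ω * (1 - ∑ r, ∑ j, protocolLoss P β n r j ω) ≤
      prob (protocolLaw P β n) E := by
    calc _ ≤ ∑ ω, E.indicator (protocolLaw P β n) (idealOutcome n ω) := by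
          refine Finset.sum_le_sum fun ω _ => ?_
          rcases (iid_nonneg hP (2 ^ n) ω).eq_or_lt with h | h
          · rw [← h, zero_mul]
            exact Set.indicator_nonneg (fun o _ => hL o) _
          · rw [Set.indicator_of_mem (hE ω h)]
            exact iid_mul_one_sub_le_protocolLaw hP hA hB h
      _ = ∑ o ∈ Finset.univ.map ⟨idealOutcome n, idealOutcome_injective n⟩,
            E.indicator (protocolLaw P β n) o := by
          rw [Finset.sum_map]
          rfl
      _ ≤ _ := Finset.sum_le_sum_of_subset_of_nonneg (Finset.subset_univ _)
          fun o _ _ => Set.indicator_nonneg (fun o _ => hL o) o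
  refine le_trans ?_ hsum
  have hexp : ∑ ω, iid P (2 ^ n) ω * ∑ r, ∑ j, protocolLoss P β n r j ω ≤
      ∑ _r : Fin t, ∑ _j : Fin (2 ^ n), 2 * √(threshold β n) := by
    simp only [Finset.mul_sum]
    rw [Finset.sum_comm]
    refine Finset.sum_le_sum fun r _ => ?_
    rw [Finset.sum_comm]
    exact Finset.sum_le_sum fun j _ => sum_mul_protocolLoss_le hP hP1 r j
  simp only [Finset.sum_const, Finset.card_univ, Fintype.card_fin, nsmul_eq_mul,
    Nat.cast_pow, Nat.cast_ofNat] at hexp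
  simp only [mul_sub, mul_one, Finset.sum_sub_distrib, sum_iid hP1]
  linarith

end ProtocolLaw

/-! ### Asymptotics of the total loss -/

section Asymptotics

open Filter

theorem eventually_mul_sqrt_le {β β' : ℝ} (hβ' : 0 < β') (h : β' < β) :
    ∀ᶠ x : ℝ in atTop, x * √((2 : ℝ) ^ (-(x ^ β))) ≤ (2 : ℝ) ^ (-(x ^ β')) := by
  have hβ : 0 < β := hβ'.trans h
  have h1 := ((tendsto_rpow_mul_exp_neg_mul_atTop_nhds_zero (1 / β) (Real.log 2 / 4)
    (by positivity)).comp (tendsto_rpow_atTop hβ)).eventually_le_const one_pos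
  have h2 := (tendsto_rpow_atTop (sub_pos.2 h)).eventually_ge_atTop 4
  filter_upwards [h1, h2, eventually_gt_atTop 0] with x hx1 hx2 hx0
  have hβx : x ^ β = x ^ β' * x ^ (β - β') := by
    rw [← Real.rpow_add hx0, add_sub_cancel]
  have hsqrt : √((2 : ℝ) ^ (-(x ^ β))) = 2 ^ (-(x ^ β / 4)) * 2 ^ (-(x ^ β / 4)) := by
    rw [Real.sqrt_eq_rpow, ← Real.rpow_mul two_pos.le, ← Real.rpow_add two_pos]
    congr 1
    ring
  have hx : x * (2 : ℝ) ^ (-(x ^ β / 4)) ≤ 1 := by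
    refine le_trans (le_of_eq ?_) hx1
    rw [Function.comp_apply, ← Real.rpow_mul hx0.le, mul_one_div_cancel hβ.ne', Real.rpow_one,
      Real.rpow_def_of_pos two_pos]
    congr 2
    ring
  rw [hsqrt, ← mul_assoc]
  refine (mul_le_of_le_one_left (by positivity) hx).trans
    (Real.rpow_le_rpow_of_exponent_le one_le_two ?_)
  have : 0 ≤ x ^ β' := by positivity
  nlinarith

/-- The total loss `N √δ_N` of a round is `O(2 ^ (-N ^ β'))`. -/
theorem isBigO_pow_mul_sqrt_threshold {β β' : ℝ} (hβ' : 0 < β') (h : β' < β) :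
    (fun n : ℕ => (2 : ℝ) ^ n * √(threshold β n)) =O[atTop]
      fun n : ℕ => (2 : ℝ) ^ (-(((2 : ℝ) ^ n) ^ β')) := by
  refine Asymptotics.IsBigO.of_bound 1 ?_
  filter_upwards [(tendsto_pow_atTop_atTop_of_one_lt one_lt_two).eventually
    (eventually_mul_sqrt_le hβ' h)] with n hn
  rw [one_mul, Real.norm_of_nonneg (by positivity), Real.norm_of_nonneg (by positivity)]
  exact hn

end Asymptotics

/-! ### Vanishing conditional entropy -/

section Determinism

variable {Ω 𝒜 ℬ : Type} [Fintype Ω] {P : Ω → ℝ}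

/-- If `H(A | B) = 0`, then `A` is almost surely a function of `B`. -/
theorem exists_eq_comp_of_condEntropy_eq_zero [Nonempty 𝒜] [Fintype 𝒜] [Fintype ℬ]
    (hP : ∀ ω, 0 ≤ P ω) {A : Ω → 𝒜} {B : Ω → ℬ} (h : condEntropy P A B = 0) :
    ∃ g : ℬ → 𝒜, ∀ ω, 0 < P ω → A ω = g (B ω) := by
  classical
  have hnn : ∀ b a, 0 ≤ Real.negMulLog (condProb P {ω | A ω = a} {ω | B ω = b}) / Real.log 2 :=
    fun b a => div_nonneg (Real.negMulLog_nonneg (condProb_nonneg hP _ _)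
      (condProb_le_one hP _ _)) (Real.log_nonneg one_le_two)
  have hone : ∀ ω, 0 < P ω → condProb P {ω' | A ω' = A ω} {ω' | B ω' = B ω} = 1 := by
    intro ω hω
    have h1 := (Finset.sum_eq_zero_iff_of_nonneg fun b _ => mul_nonneg (prob_nonneg hP _)
      (Finset.sum_nonneg fun a _ => hnn b a)).1 h (B ω) (Finset.mem_univ _)
    have h2 := (mul_eq_zero.1 h1).resolve_left 
      (prob_pos hP (E := {ω' | B ω' = B ω}) rfl hω).ne'
    have h3 := (Finset.sum_eq_zero_iff_of_nonneg fun a _ => hnn _ a).1 h2 (A ω)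
      (Finset.mem_univ _)
    have hq := condProb_pos hP (E := {ω' | A ω' = A ω}) (C := {ω' | B ω' = B ω}) rfl rfl hω
    have h4 := (div_eq_zero_iff.1 h3).resolve_right (Real.log_pos one_lt_two).ne'
    rw [Real.negMulLog, neg_mul, neg_eq_zero] at h4
    exact Real.eq_one_of_pos_of_log_eq_zero hq ((mul_eq_zero.1 h4).resolve_left hq.ne')
  have huniq : ∀ ω ω', 0 < P ω → 0 < P ω' → B ω = B ω' → A ω = A ω' := by
    intro ω ω' hω hω' hB
    by_contra hne
    have hs := sum_condProb A (prob_pos hP (E := {ω'' | B ω'' = B ω}) rfl hω).ne'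
    have hle := Finset.sum_le_univ_sum_of_nonneg (s := {A ω, A ω'}) fun a =>
      condProb_nonneg hP {ω'' | A ω'' = a} {ω'' | B ω'' = B ω}
    rw [Finset.sum_pair hne, hs, hone ω hω, hB, hone ω' hω'] at hle
    norm_num at hle
  refine ⟨fun b => if hb : ∃ ω, 0 < P ω ∧ B ω = b then A hb.choose else Classical.arbitrary 𝒜,
    fun ω hω => ?_⟩
  have hb : ∃ ω', 0 < P ω' ∧ B ω' = B ω := ⟨ω, hω, rfl⟩
  simp only [dif_pos hb]
  exact huniq _ _ hω hb.choose_spec.1 hb.choose_spec.2.symm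

end Determinism

/-! ### A linear-time machine that works on columns -/

section TrackMachine

open Function Turing StateTransition

variable {A B : Type} {m : ℕ}

/-- The alphabets of the stacks of the letterwise machine: the input stack `inl true`, the output
stack `inl false`, and one stack `inr i` for each track. Track letters carry an `Option` because
they are stored from the register, which is empty at the end of a word. -/
def TrackAlphabet (A B : Type) (m : ℕ) : Bool ⊕ Fin m → Type
  | .inl true => A
  | .inl false => B
  | .inr _ => Option A

/-- The internal states: the letter read last, and one letter from each track. -/
abbrev TrackState (A : Type) (m : ℕ) : Type := Option A × (Fin m → Option A)

/-- The statement that pops the tracks in the list `l` into the internal state, then does `q`. -/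
def popTracks {Λ : Type} (l : List (Fin m))
    (q : TM2.Stmt (TrackAlphabet A B m) Λ (TrackState A m)) :
    TM2.Stmt (TrackAlphabet A B m) Λ (TrackState A m) :=
  l.foldr (fun i q => .pop (.inr i)
    (fun v (a : Option (Option A)) => (v.1, update v.2 i a.join)) q) q

/-- The contents of the stacks of the letterwise machine. -/
def trackStacks (w : List A) (out : List B) (T : Fin m → List (Option A)) :
    ∀ k, List (TrackAlphabet A B m k)
  | .inl true => w
  | .inl false => out
  | .inr i => T i

theorem update_trackStacks_input (w w' : List A) (out : List B) (T : Fin m → List (Option A)) :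
    update (trackStacks w out T) (.inl true) w' = trackStacks w' out T := by
  funext k
  rcases k with (_ | _) | i <;> rfl

theorem update_trackStacks_output (w : List A) (out out' : List B)
    (T : Fin m → List (Option A)) :
    update (trackStacks w out T) (.inl false) out' = trackStacks w out' T := by
  funext k
  rcases k with (_ | _) | i <;> rfl

theorem update_trackStacks_track (w : List A) (out : List B) (T : Fin m → List (Option A))
    (i : Fin m) (l : List (Option A)) :
    update (trackStacks w out T) (.inr i) l = trackStacks w out (update T i l) := by
  funext k
  rcases k with (_ | _) | k
  · rfl
  · rfl
  · rcases eq_or_ne k i with rfl | h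
    · exact (update_self _ _ _).trans (update_self k l T).symm
    · exact (update_of_ne (Sum.inr_injective.ne h) _ _).trans 
        (update_of_ne h _ _ : update T i l k = T k).symm

theorem stepAux_popTracks {Λ : Type} (l : List (Fin m)) (hl : l.Nodup)
    (q : TM2.Stmt (TrackAlphabet A B m) Λ (TrackState A m)) (v : TrackState A m) (w : List A)
    (out : List B) (T : Fin m → List (Option A)) :
    TM2.stepAux (popTracks l q) v (trackStacks w out T) =
      TM2.stepAux q (v.1, fun i => if i ∈ l then (T i).head?.join else v.2 i)
        (trackStacks w out fun i => if i ∈ l then (T i).tail else T i) := by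
  induction l generalizing v T with
  | nil => simp [popTracks]
  | cons i l ih =>
    rw [List.nodup_cons] at hl
    have hstep : TM2.stepAux (popTracks (i :: l) q) v (trackStacks w out T) =
        TM2.stepAux (popTracks l q) (v.1, update v.2 i (T i).head?.join)
          (update (trackStacks w out T) (.inr i) (T i).tail) := rfl
    rw [hstep, update_trackStacks_track, ih hl.2]
    congr 2
    · funext k
      rcases eq_or_ne k i with rfl | h
      · simp [hl.1]
      · simp [h]
    · funext k
      rcases eq_or_ne k i with rfl | h
      · simp [hl.1]
      · simp [h]

theorem evalsToInTime_step {σ : Type} {f : σ → Option σ} {a b : σ} (h : f a = some b) :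
    Nonempty (EvalsToInTime f a (some b) 1) :=
  ⟨⟨⟨1, h⟩, le_rfl⟩⟩

theorem evalsToInTime_trans {σ : Type} {f : σ → Option σ} {a b : σ} {c : Option σ} {k l r : ℕ}
    (h₁ : Nonempty (EvalsToInTime f a (some b) k)) (h₂ : Nonempty (EvalsToInTime f b c l))
    (h : k + l ≤ r) : Nonempty (EvalsToInTime f a c r) := by
  obtain ⟨h₁⟩ := h₁
  obtain ⟨h₂⟩ := h₂
  have h₃ := h₁.trans _ _ _ _ _ _ h₂
  exact ⟨⟨h₃.toEvalsTo, h₃.steps_le_m.trans (by omega)⟩⟩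

variable [NeZero m]

/-- The program of the letterwise machine. At `inl true` it reads a letter and, at the label of
its track, stores it there; at the end of the input it goes to `inl false`, where it pops all
tracks at once and writes the letter that `g` assigns to the column, until the tracks are empty. -/
def trackProgram (track : A → Fin m) (g : (Fin m → Option A) → B) :
    Bool ⊕ Fin m → TM2.Stmt (TrackAlphabet A B m) (Bool ⊕ Fin m) (TrackState A m)
  | .inl true => .pop (.inl true) (fun v (a : Option A) => (a, v.2))
      (.goto fun v => v.1.elim (.inl false) fun a => .inr (track a))
  | .inr i => .push (.inr i) (fun v => v.1) (.goto fun _ => .inl true)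
  | .inl false => popTracks (List.finRange m)
      (.branch (fun v => (v.2 0).isSome)
        (.push (.inl false) (fun v => g v.2)
          (.load (fun _ => (none, fun _ => none)) (.goto fun _ => .inl false)))
        (.load (fun _ => (none, fun _ => none)) .halt))

/-- The letterwise machine, with all its stack alphabets and its set of states finite. -/
def trackMachine [Fintype A] (track : A → Fin m) (g : (Fin m → Option A) → B) : FinTM2 where
  K := Bool ⊕ Fin m
  kDecidableEq := inferInstance
  k₀ := .inl true
  k₁ := .inl false
  Γ := TrackAlphabet A B m
  Λ := Bool ⊕ Fin m
  main := .inl true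
  σ := TrackState A m
  initialState := (none, fun _ => none)
  Γk₀Fin := inferInstanceAs (Fintype A)
  m := trackProgram track g

variable (track : A → Fin m) (g : (Fin m → Option A) → B)

/-- The reading phase distributes the input word to the tracks, in reversed order. -/
theorem trackProgram_read (w : List A) (v : Option A) (out : List B)
    (T : Fin m → List (Option A)) :
    Nonempty (EvalsToInTime (TM2.step (trackProgram track g))
      ⟨some (.inl true), (v, fun _ => none), trackStacks w out T⟩
      (some ⟨some (.inl false), (none, fun _ => none), trackStacks [] out fun i =>
        ((w.filter fun a => track a = i).map some).reverse ++ T i⟩) (2 * w.length + 1)) := by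
  induction w generalizing v T with
  | nil =>
    refine evalsToInTime_step ?_
    exact congrArg (fun S => some (TM2.Cfg.mk (some (Sum.inl false)) (none, fun _ => none) S))
      (update_trackStacks_input [] [] out T)
  | cons a w ih =>
    have h₁ : TM2.step (trackProgram track g)
        ⟨some (.inl true), (v, fun _ => none), trackStacks (a :: w) out T⟩ =
        some ⟨some (.inr (track a)), (some a, fun _ => none), trackStacks w out T⟩ :=
      congrArg (fun S => some (TM2.Cfg.mk (some (Sum.inr (track a))) (some a, fun _ => none) S))
        (update_trackStacks_input (a :: w) w out T)
    have h₂ : TM2.step (trackProgram track g)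
        ⟨some (.inr (track a)), (some a, fun _ => none), trackStacks w out T⟩ =
        some ⟨some (.inl true), (some a, fun _ => none),
          trackStacks w out (update T (track a) (some a :: T (track a)))⟩ :=
      congrArg (fun S => some (TM2.Cfg.mk (some (Sum.inl true)) (some a, fun _ => none) S))
        (update_trackStacks_track w out T (track a) (some a :: T (track a)))
    have h := evalsToInTime_trans (evalsToInTime_step h₁) (evalsToInTime_trans
      (evalsToInTime_step h₂) (ih (some a) (update T (track a) (some a :: T (track a)))) le_rfl)
      (r := 2 * (a :: w).length + 1) (by rw [List.length_cons]; omega)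
    convert h using 5
    funext i
    rcases eq_or_ne (track a) i with rfl | hi
    · simp
    · simp [hi, hi.symm]

/-- The writing phase empties tracks of equal length and writes the image of every column. -/
theorem trackProgram_write (N : ℕ) (c : Fin m → Fin N → A) (out : List B) :
    Nonempty (EvalsToInTime (TM2.step (trackProgram track g))
      ⟨some (.inl false), (none, fun _ => none), trackStacks [] out fun i =>
        ((List.ofFn (c i)).map some).reverse⟩
      (some ⟨none, (none, fun _ => none), trackStacks []
        (List.ofFn (fun j => g fun i => some (c i j)) ++ out) fun _ => []⟩) (N + 1)) := by
  induction N generalizing out with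
  | zero =>
    refine evalsToInTime_step ?_
    rw [TM2.step, trackProgram, stepAux_popTracks _ (List.nodup_finRange m)]
    simp
  | succ N ih =>
    have h₁ : TM2.step (trackProgram track g)
        ⟨some (.inl false), (none, fun _ => none), trackStacks [] out fun i =>
          ((List.ofFn (c i)).map some).reverse⟩ =
        some ⟨some (.inl false), (none, fun _ => none), trackStacks []
          ((g fun i => some (c i (Fin.last N))) :: out) fun i =>
            ((List.ofFn fun j : Fin N => c i j.castSucc).map some).reverse⟩ := by
      rw [TM2.step, trackProgram, stepAux_popTracks _ (List.nodup_finRange m)]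
      simp only [List.mem_finRange, if_true, List.ofFn_succ', List.concat_eq_append,
        List.map_append, List.map_cons, List.map_nil, List.reverse_append, List.reverse_cons,
        List.reverse_nil, List.nil_append, List.singleton_append, List.head?_cons,
        Option.join_some, List.tail_cons, TM2.stepAux, Option.isSome_some, cond_true]
      exact congrArg (fun S => some (TM2.Cfg.mk (some (Sum.inl false)) (none, fun _ => none) S))
        (update_trackStacks_output [] out _ _)
    have h := evalsToInTime_trans (evalsToInTime_step h₁)
      (ih (fun i j => c i j.castSucc) ((g fun i => some (c i (Fin.last N))) :: out))
      (r := N + 1 + 1) (by omega)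
    convert h using 5
    rw [List.ofFn_succ', List.concat_eq_append, List.append_assoc]
    rfl

/-- If the letters of every track form, in their order, a sequence of length `N`, then the
letterwise machine computes the sequence of images of the columns in linear time. -/
theorem trackMachine_outputsInTime [Fintype A] {N : ℕ} {w : List A} {c : Fin m → Fin N → A}
    (hw : ∀ i, w.filter (fun a => track a = i) = List.ofFn (c i)) :
    Nonempty (TM2OutputsInTime (trackMachine track g) w
      (some (List.ofFn fun j => g fun i => some (c i j))) (2 * w.length + 1 + (N + 1))) := by
  have hread := trackProgram_read track g w none [] fun _ => []
  simp only [hw, List.append_nil] at hread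
  have h := evalsToInTime_trans hread (trackProgram_write track g N c []) le_rfl
  rw [List.append_nil] at h
  have hinit : initList (trackMachine track g) w =
      ⟨some (.inl true), (none, fun _ => none), trackStacks w [] fun _ => []⟩ := by
    unfold initList
    congr 1
    funext k
    rcases k with (_ | _) | k <;> rfl
  have hhalt : haltList (trackMachine track g) (List.ofFn fun j => g fun i => some (c i j)) =
      ⟨none, (none, fun _ => none),
        trackStacks [] (List.ofFn fun j => g fun i => some (c i j)) fun _ => []⟩ := by
    unfold haltList
    congr 1
    funext k
    rcases k with (_ | _) | k <;> rfl
  unfold TM2OutputsInTime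
  rw [hinit, Option.map_some, hhalt]
  exact h

end TrackMachine

/-! ### Letterwise functions of the input word -/

section Letterwise

open Turing

variable {𝒳 𝒵 : Type} {t : ℕ}

/-- The sequence of the input word to which a letter belongs. -/
def inputTrack (a : 𝒳 ⊕ Fin t × ZMod 2) : Fin (t + 1) :=
  a.elim (fun _ => 0) fun z => z.1.succ

theorem length_inputWord {N : ℕ} (x : Fin N → 𝒳) (u : Fin t → Fin N → ZMod 2) :
    (inputWord x u).length = (t + 1) * N := by
  simp [inputWord, List.length_flatten, List.map_ofFn, Function.comp_def]
  ring

theorem flatten_ofFn_ite {α : Type} (s : Fin t) (l : Fin t → List α) :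
    (List.ofFn fun r => if r = s then l r else []).flatten = l s := by
  induction t with
  | zero => exact s.elim0
  | succ t ih =>
    rw [List.ofFn_succ, List.flatten_cons]
    cases s using Fin.cases with
    | zero => simp [Fin.succ_ne_zero]
    | succ s => simpa [(Fin.succ_ne_zero s).symm] using ih s fun r => l r.succ

theorem filter_inputWord {N : ℕ} (x : Fin N → 𝒳) (u : Fin t → Fin N → ZMod 2) (i : Fin (t + 1)) :
    (inputWord x u).filter (fun a => inputTrack a = i) =
      List.ofFn fun j => Fin.cases (motive := fun _ => 𝒳 ⊕ Fin t × ZMod 2) (Sum.inl (x j))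
        (fun r => Sum.inr (r, u r j)) i := by
  rw [inputWord, List.filter_append, List.filter_flatten, List.map_ofFn]
  cases i using Fin.cases with
  | zero =>
    have h : ∀ r : Fin t, (List.ofFn fun j => (Sum.inr (r, u r j) : 𝒳 ⊕ Fin t × ZMod 2)).filter
        (fun a => inputTrack a = 0) = [] := fun r => by
      simp [List.filter_eq_nil_iff, inputTrack]
    simp only [Function.comp_def, h, Fin.cases_zero]
    have h' : (List.ofFn fun j => (Sum.inl (x j) : 𝒳 ⊕ Fin t × ZMod 2)).filter
        (fun a => inputTrack a = 0) = List.ofFn fun j => Sum.inl (x j) := by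
      simp [List.filter_eq_self, inputTrack]
    rw [h']
    simp
  | succ s =>
    have h : ∀ r : Fin t, (List.ofFn fun j => (Sum.inr (r, u r j) : 𝒳 ⊕ Fin t × ZMod 2)).filter
        (fun a => inputTrack a = s.succ) =
          if r = s then List.ofFn fun j => Sum.inr (r, u r j) else [] := fun r => by
      split_ifs with hr
      · simp [List.filter_eq_self, inputTrack, hr]
      · simp [List.filter_eq_nil_iff, inputTrack, hr]
    have h' : (List.ofFn fun j => (Sum.inl (x j) : 𝒳 ⊕ Fin t × ZMod 2)).filter
        (fun a => inputTrack a = s.succ) = [] := by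
      simp [List.filter_eq_nil_iff, inputTrack, (Fin.succ_ne_zero s).symm]
    simp only [Function.comp_def, h, h', List.nil_append, Fin.cases_succ]
    exact flatten_ofFn_ite s fun r => List.ofFn fun j => Sum.inr (r, u r j)

/-- A function that is applied letter by letter is computable in linear time. -/
theorem computableInLinearTime_letterwise [Fintype 𝒳] [Nonempty 𝒳]
    (g : 𝒳 → (Fin t → ZMod 2) → 𝒵) :
    ComputableInLinearTime fun (N : ℕ) (x : Fin N → 𝒳) (u : Fin t → Fin N → ZMod 2) j =>
      g (x j) fun r => u r j := by
  classical
  -- Letters of a column that are missing or belong to another track are replaced arbitrarily.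
  let column : (Fin (t + 1) → Option (𝒳 ⊕ Fin t × ZMod 2)) → 𝒵 := fun a =>
    g ((a 0).elim (Classical.arbitrary 𝒳) fun l => l.elim id fun _ => Classical.arbitrary 𝒳)
      fun r => (a r.succ).elim 0 fun l => l.elim (fun _ => 0) fun z => z.2
  refine ⟨⟨trackMachine inputTrack column, Equiv.refl _, Equiv.refl _⟩, 2 * t + 4,
    fun N x u => ?_⟩
  obtain ⟨h⟩ := trackMachine_outputsInTime inputTrack column (filter_inputWord x u)
  have key : ∀ (w : List (𝒳 ⊕ Fin t × ZMod 2)) (out : List 𝒵), w = inputWord x u →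
      (out = List.ofFn fun j => g (x j) fun r => u r j) →
      Nonempty (TM2OutputsInTime (trackMachine inputTrack column) w (some out)
        ((2 * t + 4) * (N + 1))) := by
    rintro _ _ rfl rfl
    refine ⟨⟨h.toEvalsTo, h.steps_le_m.trans ?_⟩⟩
    rw [length_inputWord]
    nlinarith
  exact key _ _ (List.map_id _) (List.map_id _)

end Letterwise

end InteractivePolar

/-! ### Correctness of both computations -/

theorem proposition4 {X Y ZA ZB : Type} [Fintype X] [Fintype Y] [Fintype ZA] [Fintype ZB]
    (t : ℕ) (p : PMF (X × Y × (Fin t → ZMod 2))) (P : X × Y × (Fin t → ZMod 2) → ℝ)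
    (hP : P = fun ω => (p ω).toReal)
    (fA : X → Y → ZA) (fB : X → Y → ZB)
    (hMarkovA : ∀ r : Fin t, Even (r : ℕ) →
      IsMarkovChain P (fun ω => ω.2.2 r) (fun ω => (ω.1, past r ω.2.2)) (fun ω => ω.2.1))
    (hMarkovB : ∀ r : Fin t, Odd (r : ℕ) →
      IsMarkovChain P (fun ω => ω.2.2 r) (fun ω => (ω.2.1, past r ω.2.2)) (fun ω => ω.1))
    (hEntropyA : condEntropy P (fun ω => fA ω.1 ω.2.1) (fun ω => (ω.1, ω.2.2)) = 0)
    (hEntropyB : condEntropy P (fun ω => fB ω.1 ω.2.1) (fun ω => (ω.2.1, ω.2.2)) = 0) :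
    (∃ Z : (N : ℕ) → (Fin N → X) → (Fin t → Fin N → ZMod 2) → Fin N → ZA,
      ComputableInLinearTime Z ∧
      ∀ β β₇ : ℝ, 0 < β₇ → β₇ < β → β < 1 / 2 →
        (fun n : ℕ => 1 - prob (protocolLaw P β n)
            {o | Z (2 ^ n) o.1 (decodeAux o.2.2.1) = fun j => fA (o.1 j) (o.2.1 j)})
          =O[Filter.atTop] fun n : ℕ => (2 : ℝ) ^ (-(((2 : ℝ) ^ n) ^ β₇))) ∧
    (∃ Z : (N : ℕ) → (Fin N → Y) → (Fin t → Fin N → ZMod 2) → Fin N → ZB,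
      ComputableInLinearTime Z ∧
      ∀ β β₇ : ℝ, 0 < β₇ → β₇ < β → β < 1 / 2 →
        (fun n : ℕ => 1 - prob (protocolLaw P β n)
            {o | Z (2 ^ n) o.2.1 (decodeAux o.2.2.2) = fun j => fB (o.1 j) (o.2.1 j)})
          =O[Filter.atTop] fun n : ℕ => (2 : ℝ) ^ (-(((2 : ℝ) ^ n) ^ β₇))) := by
  have hP0 : ∀ ω, 0 ≤ P ω := fun ω => by
    rw [hP]
    exact ENNReal.toReal_nonneg
  have hP1 : ∑ ω, P ω = 1 := by
    have h := p.tsum_coe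
    rw [tsum_fintype] at h
    rw [hP, ← ENNReal.toReal_sum fun ω _ => p.apply_ne_top ω, h, ENNReal.toReal_one]
  obtain ⟨ω₀, -⟩ := p.support_nonempty
  have : Nonempty X := ⟨ω₀.1⟩
  have : Nonempty Y := ⟨ω₀.2.1⟩
  have : Nonempty ZA := ⟨fA ω₀.1 ω₀.2.1⟩
  have : Nonempty ZB := ⟨fB ω₀.1 ω₀.2.1⟩
  have hpos : ∀ {N : ℕ} {ω : Fin N → Sample X Y t}, 0 < iid P N ω → ∀ j, 0 < P (ω j) :=
    fun hω j => (hP0 _).lt_of_ne' fun h => hω.ne' (Finset.prod_eq_zero (Finset.mem_univ j) h)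
  have hbound : ∀ {β β₇ : ℝ}, 0 < β₇ → β₇ < β → ∀ E : ∀ n, Set (Outcome X Y t n),
      (∀ n ω, 0 < iid P (2 ^ n) ω → idealOutcome n ω ∈ E n) →
      (fun n : ℕ => 1 - prob (protocolLaw P β n) (E n)) =O[Filter.atTop]
        fun n : ℕ => (2 : ℝ) ^ (-(((2 : ℝ) ^ n) ^ β₇)) := by
    intro β β₇ h0 h1 E hE
    refine Asymptotics.IsBigO.trans (Asymptotics.IsBigO.of_bound (2 * t) (Filter.Eventually.of_forall
      fun n => ?_)) (isBigO_pow_mul_sqrt_threshold h0 h1)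
    rw [Real.norm_of_nonneg (by positivity : 0 ≤ (2 : ℝ) ^ n * √(threshold β n))]
    exact abs_one_sub_prob_protocolLaw_le hP0 hP1 hMarkovA hMarkovB (hE n)
  obtain ⟨gA, hgA⟩ := exists_eq_comp_of_condEntropy_eq_zero hP0 hEntropyA
  obtain ⟨gB, hgB⟩ := exists_eq_comp_of_condEntropy_eq_zero hP0 hEntropyB
  refine ⟨⟨_, computableInLinearTime_letterwise fun x u => gA (x, u),
      fun β β₇ h0 h1 _ => hbound h0 h1 _ fun n ω hω => ?_⟩,
    ⟨_, computableInLinearTime_letterwise fun y u => gB (y, u),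
      fun β β₇ h0 h1 _ => hbound h0 h1 _ fun n ω hω => ?_⟩⟩
  · funext j
    simp only [idealOutcome, decodeAux_auxTransform]
    exact (hgA (ω j) (hpos hω j)).symm
  · funext j
    simp only [idealOutcome, decodeAux_auxTransform]
    exact (hgB (ω j) (hpos hω j)).symm
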